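/- Let $\mathbb{T}=\mathbb{R}/\mathbb{Z}$, let $\xi$ be a space-time white noise on $[0,1]\times\mathbb{T}$ over a probability space $(\Omega,\mathcal{F},\mathbb{P})$ (a centred Gaussian family $(\xi(A))_A$ in $L^2(\Omega)$, indexed by the Borel sets $A\subset[0,1]\times\mathbb{T}$, with $\mathbb{E}[\xi(A)\xi(B)]=\lambda(A\cap B)$, $\lambda$ being the Lebesgue measure), let $p_t(x)=\sum_{k\in\mathbb{Z}}e^{-4\pi^2k^2t}e^{2\pi i kx}$ be the heat kernel on $\mathbb{T}$, let $P_tg=p_t\ast g$ for $t>0$ and $P_0g=g$, and let $$O_t(x)=\int_0^t\int_{\mathbb{T}}p_{t-s}(x-y)\,\xi(ds,dy),\qquad t\in[0,1],\ x\in\mathbb{T},$$ be (a continuous version of) the stochastic convolution. Let $u$ be the continuous mild solution on $[0,1]$ of the linear equation $\partial_tu=\Delta u+u+\xi$ with $u_0=0$, that is, almost surely $$u_t=\int_0^tP_{t-s}u_s\,ds+O_t\qquad\text{for all } t\in[0,1].$$ For $M,N\in\mathbb{N}$, $M\ge1$, let $$\mathcal{G}_{M,[-N,N]}=\sigma\big(\hat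 O_{k/M}(n):\ k=0,\dots,M,\ n\in\mathbb{Z},\ |n|\le N\big),\qquad \hat O_t(n)=\int_{\mathbb{T}}e^{-2\pi i nx}O_t(x)\,dx .$$ Then $u_1\in L^2(\Omega;L^2(\mathbb{T}))$, and there is an absolute constant $K\in\mathbb{N}$ such that for all $M,N\ge K$ $$\inf_{Z}\big\|\,\|u_1-Z\|_{L^2(\mathbb{T})}\big\|_{L^2(\Omega)}=\big\|\,\|u_1-\mathbb{E}(u_1\mid\mathcal{G}_{M,[-N,N]})\|_{L^2(\mathbb{T})}\big\|_{L^2(\Omega)}\ \ge\ \frac{M^{-1}+N^{-1/2}}{30},$$ where the infimum is over all $\mathcal{G}_{M,[-N,N]}$-measurable random variables $Z$ with values in $L^2(\mathbb{T})$. -/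

import Mathlib

open MeasureTheory ProbabilityTheory Set
open scoped ENNReal

noncomputable section

namespace StochHeat

/-- The Borel subsets of the space-time cylinder `[0, T] × 𝕋`, where `𝕋 = ℝ / ℤ`. -/
abbrev CylSet (T : ℝ) : Type :=
  {A : Set (ℝ × UnitAddCircle) // MeasurableSet A ∧ A ⊆ Icc 0 T ×ˢ univ}

/-- Lebesgue measure on `[0, T] × 𝕋`. -/
def cylMeasure (T : ℝ) : Measure (ℝ × UnitAddCircle) :=
  volume.restrict (Icc 0 T ×ˢ univ)

section Noise

variable {Ω : Type*} [MeasurableSpace Ω] {P : Measure Ω} {T : ℝ}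

/-- Space-time white noise on `[0, T] × 𝕋`: a map `ξ` from the Borel sets into `L²(Ω)` such that
`(ξ A)` is a centred Gaussian family with `𝔼[ξ A ξ B] = λ(A ∩ B)`. -/
structure IsWhiteNoise (ξ : CylSet T → Lp ℝ 2 P) : Prop where
  gaussian : IsGaussianProcess (fun A ω => ξ A ω) P
  mean_zero : ∀ A, ∫ ω, ξ A ω ∂P = 0
  covariance : ∀ A B, ∫ ω, ξ A ω * ξ B ω ∂P = volume.real (A.1 ∩ B.1)

instance : IsFiniteMeasure (cylMeasure T) := by
  constructor
  rw [cylMeasure, Measure.restrict_apply_univ, Measure.volume_eq_prod, Measure.prod_prod]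
  simp

/-- The indicator function `1_A` as an element of `L²([0, T] × 𝕋)`. -/
def cylIndicator (A : CylSet T) : Lp ℝ 2 (cylMeasure T) :=
  indicatorConstLp 2 A.2.1 (measure_ne_top _ _) (1 : ℝ)

/-- The integral `L²([0, T] × 𝕋) → L²(Ω)` of deterministic integrands with respect to `ξ`:
the continuous linear extension of `1_A ↦ ξ A`. That it is indeed an extension, that it is isometric
and that it is unique is shown below for every white noise `ξ`. -/
def wienerIntegral (ξ : CylSet T → Lp ℝ 2 P) : Lp ℝ 2 (cylMeasure T) →L[ℝ] Lp ℝ 2 P :=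
  (Finsupp.linearCombination ℝ ξ).extendOfNorm (Finsupp.linearCombination ℝ cylIndicator)

theorem denseRange_cylIndicator :
    DenseRange (Finsupp.linearCombination ℝ (cylIndicator (T := T))) := by
  have hcl : IsClosed
      ((LinearMap.range (Finsupp.linearCombination ℝ (cylIndicator (T := T)))).topologicalClosure :
        Set (Lp ℝ 2 (cylMeasure T))) := Submodule.isClosed_topologicalClosure _
  intro g
  change g ∈ closure
    ((LinearMap.range (Finsupp.linearCombination ℝ (cylIndicator (T := T))) :
      Submodule ℝ _) : Set (Lp ℝ 2 (cylMeasure T)))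
  rw [← Submodule.topologicalClosure_coe]
  induction g using Lp.induction (by norm_num : (2 : ℝ≥0∞) ≠ ∞) with
  | @indicatorConst c s hs hμs =>
    apply Submodule.le_topologicalClosure
    have hS : MeasurableSet (Icc (0 : ℝ) T ×ˢ (univ : Set UnitAddCircle)) :=
      measurableSet_Icc.prod MeasurableSet.univ
    refine ⟨Finsupp.single ⟨s ∩ Icc 0 T ×ˢ univ, hs.inter hS, inter_subset_right⟩ c, ?_⟩
    rw [Finsupp.linearCombination_single]
    apply Lp.ext
    have h1 : (s ∩ Icc (0 : ℝ) T ×ˢ (univ : Set UnitAddCircle) : Set _) =ᵐ[cylMeasure T] s := by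
      have : ∀ᵐ z ∂cylMeasure T, z ∈ Icc (0 : ℝ) T ×ˢ (univ : Set UnitAddCircle) :=
        ae_restrict_mem hS
      filter_upwards [this] with z hz
      exact propext ⟨fun h => h.1, fun h => ⟨h, hz⟩⟩
    have e1 : (Lp.simpleFunc.indicatorConst 2 hs hμs.ne c : Lp ℝ 2 (cylMeasure T))
        = indicatorConstLp 2 hs hμs.ne c := rfl
    rw [e1]
    filter_upwards [Lp.coeFn_smul c (cylIndicator (T := T)
        ⟨s ∩ Icc 0 T ×ˢ univ, hs.inter hS, inter_subset_right⟩),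
      indicatorConstLp_coeFn (p := 2) (hs := hs.inter hS)
        (hμs := measure_ne_top (cylMeasure T) _) (c := (1 : ℝ)),
      indicatorConstLp_coeFn (p := 2) (hs := hs) (hμs := hμs.ne) (c := c), h1]
      with z hz1 hz2 hz3 hz4
    rw [hz1, hz3, Pi.smul_apply]
    change c • (indicatorConstLp 2 (hs.inter hS) (measure_ne_top (cylMeasure T) _) (1 : ℝ)) z = _
    rw [hz2]
    have hz5 : z ∈ s ∩ Icc (0 : ℝ) T ×ˢ (univ : Set UnitAddCircle) ↔ z ∈ s := Iff.of_eq hz4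
    by_cases hzs : z ∈ s
    · rw [indicator_of_mem (hz5.2 hzs), indicator_of_mem hzs]; simp
    · rw [indicator_of_notMem (fun h => hzs (hz5.1 h)), indicator_of_notMem hzs]; simp
  | add hf hg _ ihf ihg => exact Submodule.add_mem _ ihf ihg
  | isClosed => exact hcl

theorem IsWhiteNoise.norm_linearCombination {ξ : CylSet T → Lp ℝ 2 P} (hξ : IsWhiteNoise ξ)
    (v : CylSet T →₀ ℝ) :
    ‖Finsupp.linearCombination ℝ ξ v‖ = ‖Finsupp.linearCombination ℝ cylIndicator v‖ := by
  have key : ∀ A B : CylSet T, inner ℝ (ξ A) (ξ B) = inner ℝ (cylIndicator A) (cylIndicator B) := by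
    intro A B
    rw [cylIndicator, cylIndicator, L2.real_inner_indicatorConstLp_one_indicatorConstLp_one,
      L2.inner_def]
    have h := hξ.covariance A B
    have h2 : (cylMeasure T).real (A.1 ∩ B.1) = volume.real (A.1 ∩ B.1) := by
      rw [cylMeasure, measureReal_restrict_apply (A.2.1.inter B.2.1),
        inter_eq_left.2 (inter_subset_left.trans A.2.2)]
    rw [h2, ← h]
    refine integral_congr_ae (Filter.Eventually.of_forall fun ω => ?_)
    simp [mul_comm]
  rw [← sq_eq_sq₀ (norm_nonneg _) (norm_nonneg _), ← real_inner_self_eq_norm_sq,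
    ← real_inner_self_eq_norm_sq]
  simp only [Finsupp.linearCombination_apply, Finsupp.sum, sum_inner, inner_sum,
    real_inner_smul_left, real_inner_smul_right, key]

theorem IsWhiteNoise.wienerIntegral_indicator {ξ : CylSet T → Lp ℝ 2 P} (hξ : IsWhiteNoise ξ)
    (A : CylSet T) : wienerIntegral ξ (cylIndicator A) = ξ A := by
  have h := LinearMap.extendOfNorm_eq (f := Finsupp.linearCombination ℝ ξ)
    denseRange_cylIndicator
    ⟨1, fun v => by rw [one_mul]; exact (hξ.norm_linearCombination v).le⟩ (Finsupp.single A 1)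
  simpa [wienerIntegral] using h

theorem IsWhiteNoise.norm_wienerIntegral {ξ : CylSet T → Lp ℝ 2 P} (hξ : IsWhiteNoise ξ)
    (g : Lp ℝ 2 (cylMeasure T)) : ‖wienerIntegral ξ g‖ = ‖g‖ := by
  refine denseRange_cylIndicator.induction (P := fun g => ‖wienerIntegral ξ g‖ = ‖g‖) ?_
    (isClosed_eq (by fun_prop) (by fun_prop)) g
  rintro _ ⟨v, rfl⟩
  rw [wienerIntegral, LinearMap.extendOfNorm_eq denseRange_cylIndicator
    ⟨1, fun v => by rw [one_mul]; exact (hξ.norm_linearCombination v).le⟩,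
    hξ.norm_linearCombination]

theorem IsWhiteNoise.wienerIntegral_unique {ξ : CylSet T → Lp ℝ 2 P} (hξ : IsWhiteNoise ξ)
    (I : Lp ℝ 2 (cylMeasure T) →L[ℝ] Lp ℝ 2 P) (hI : ∀ A, I (cylIndicator A) = ξ A) :
    wienerIntegral ξ = I := by
  refine LinearMap.extendOfNorm_unique denseRange_cylIndicator 1
    (fun v => by rw [one_mul]; exact (hξ.norm_linearCombination v).le) I ?_
  ext A : 2
  simp [hI]

open Classical in
/-- `∫₀ᵀ ∫_𝕋 g(s, y) ξ(ds, dy)` for a function `g`, with value `0` if `g` is not square integrable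
on `[0, T] × 𝕋`. -/
def noiseIntegral (ξ : CylSet T → Lp ℝ 2 P) (g : ℝ × UnitAddCircle → ℝ) : Lp ℝ 2 P :=
  if hg : MemLp g 2 (cylMeasure T) then wienerIntegral ξ (hg.toLp g) else 0

end Noise

/-- The periodic heat kernel `p_t(x) = ∑_{k ∈ ℤ} exp(-4 π² k² t) exp(2 π i k x)`, for `t > 0`.
(The sum is real.) -/
def heatKernel (t : ℝ) (x : UnitAddCircle) : ℝ :=
  (∑' k : ℤ, (Real.exp (-4 * Real.pi ^ 2 * (k : ℝ) ^ 2 * t) : ℂ) * fourier k x).re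

/-- The heat semigroup: `P_0 g = g`, and `P_t g = p_t ∗ g` for `t > 0`. -/
def heatSemigroup (t : ℝ) (g : UnitAddCircle → ℝ) (x : UnitAddCircle) : ℝ :=
  if t = 0 then g x else ∫ y, heatKernel t (x - y) * g y

section Processes

variable {Ω : Type*} [MeasurableSpace Ω]

/-- A random field on `[0, T] × 𝕋`, seen as a process with values in `C(𝕋)`, with almost surely
continuous paths `[0, T] → C(𝕋)`. -/
structure IsContinuousField (P : Measure Ω) (T : ℝ) (X : ℝ → Ω → C(UnitAddCircle, ℝ)) : Prop where
  measurable : ∀ t ∈ Icc 0 T, ∀ x, Measurable fun ω => X t ω x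
  continuousOn : ∀ᵐ ω ∂P, ContinuousOn (fun t => X t ω) (Icc 0 T)

/-- `O` is (a continuous version of) the stochastic convolution
`O_t(x) = ∫₀ᵗ ∫_𝕋 p_{t-s}(x - y) ξ(ds, dy)`, `t ∈ [0, T]`. -/
structure IsStochasticConvolution {P : Measure Ω} {T : ℝ} (ξ : CylSet T → Lp ℝ 2 P)
    (O : ℝ → Ω → C(UnitAddCircle, ℝ)) : Prop where
  field : IsContinuousField P T O
  eq_integral : ∀ t ∈ Icc 0 T, ∀ x, (fun ω => O t ω x) =ᵐ[P]
    noiseIntegral ξ fun z => (Iio t).indicator (fun s => heatKernel (t - s) (x - z.2)) z.1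

/-- `u` is a mild solution on `[0, T]` of `∂ₜu = Δu + f(u) + ξ` with initial condition `u₀`, where
`O` is the stochastic convolution of `ξ`: almost surely, for all `t` and `x`,
`u_t = P_t u₀ + ∫₀ᵗ P_{t-s}(f(u_s)) ds + O_t`. -/
structure IsMildSolution (P : Measure Ω) (T : ℝ) (f : ℝ → ℝ) (u₀ : Ω → C(UnitAddCircle, ℝ))
    (O u : ℝ → Ω → C(UnitAddCircle, ℝ)) : Prop where
  field : IsContinuousField P T u
  mild : ∀ᵐ ω ∂P, ∀ t ∈ Icc 0 T, ∀ x,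
    u t ω x = heatSemigroup t (u₀ ω) x
      + (∫ s in (0)..t, heatSemigroup (t - s) (fun y => f (u s ω y)) x) + O t ω x

/-- The σ-algebra `𝒢_{M,I}` generated by the Fourier coefficients `Ô_{t_k}(n)` at the grid points
`t_k = k T / M`, `k = 0, …, M`, with `n ∈ I ∩ ℤ`. -/
@[reducible]
def gridSigma (T : ℝ) (O : ℝ → Ω → C(UnitAddCircle, ℝ)) (M : ℕ) (I : Set ℝ) :
    MeasurableSpace Ω :=
  ⨆ k : Fin (M + 1), ⨆ n : {n : ℤ // (n : ℝ) ∈ I},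
    MeasurableSpace.comap
      (fun ω => fourierCoeff (fun x => (O (k.1 * (T / M)) ω x : ℂ)) n.1) inferInstance

/-- A continuous function as an element of `L²(𝕋)`. -/
def toL2 (g : C(UnitAddCircle, ℝ)) : Lp ℝ 2 (volume : Measure UnitAddCircle) :=
  ContinuousMap.toLp 2 volume ℝ g

end Processes

/-- The error `‖ ‖U - Z‖_{L²(𝕋)} ‖_{L²(Ω)}`, as an element of `[0, ∞]`. -/
def l2Error {Ω : Type*} [MeasurableSpace Ω] (P : Measure Ω) (U Z : Ω → Lp ℝ 2 (volume : Measure UnitAddCircle)) : ℝ≥0∞ :=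
  eLpNorm (fun ω => U ω - Z ω) 2 P

/-- The infimum of `‖ ‖U - Z‖_{L²(𝕋)} ‖_{L²(Ω)}` over all `G`-measurable `L²(𝕋)`-valued `Z`.
(Since `L²(𝕋)` is separable, strong measurability is Borel measurability.) -/
def bestError {Ω : Type*} (G : MeasurableSpace Ω) [MeasurableSpace Ω] (P : Measure Ω)
    (U : Ω → Lp ℝ 2 (volume : Measure UnitAddCircle)) : ℝ≥0∞ :=
  ⨅ Z : {Z : Ω → Lp ℝ 2 (volume : Measure UnitAddCircle) // StronglyMeasurable[G] Z},
    l2Error P U Z.1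

/-- The error `‖ ‖U - 𝔼(U | G)‖_{L²(𝕋)} ‖_{L²(Ω)}`. -/
def condExpError {Ω : Type*} (G : MeasurableSpace Ω) [MeasurableSpace Ω] (P : Measure Ω)
    (U : Ω → Lp ℝ 2 (volume : Measure UnitAddCircle)) : ℝ≥0∞ :=
  l2Error P U (P[U | G])

end StochHeat

end

/-!
The equation decouples into Fourier modes. Pairing the mild equation with an eigenfunction of the
heat semigroup gives a scalar Volterra equation, solved by variation of constants
(`volterra_solution`, `integral_mildSolution_mul`): for decay rate `l`, the mode of `u` at time `1`
is `o_1 + ∫₀¹ exp((1 - l)(1 - s)) o_s ds`, where `o` is the mode of the stochastic convolution. By a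
stochastic Fubini theorem (`IsStochasticConvolution.integral_mul_ae_eq`), `o_s` is the noise integral
of `(r, y) ↦ 1_{r < s} exp(-l (s - r)) f(y)`. So all second moments are explicit. Those of the
frequency `n` are of order `n⁻²`, and summing them by Parseval places `u_1` in `L²`
(`IsMildSolution.memLp_toL2`). The best approximation is then the conditional expectation, since
this is the orthogonal projection (`bestError_eq_condExpError`).

For the lower bound, noise integrals are jointly Gaussian, so one whose integrand is orthogonal to
the integrands of all observed modes is independent of the observations and has zero conditional
expectation (`IsWhiteNoise.condExp_noiseIntegral_eq_zero`). Testing the error against such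
variables along an orthonormal family bounds it from below, by Bessel and Cauchy-Schwarz
(`sum_le_integral_norm_sub_condExp_sq`). Two kinds of test variables are used:

* at frequency `0`, the integrand `sin(2 π M r)`. Its integral up to each grid time vanishes, so it
  is invisible to the observations, but its covariance with the time integral in the solution is at
  least `(2 π M)⁻¹` (`le_integral_mean_mul_gridSine`);
* at the unobserved frequencies `N < k ≤ 2N`, the mode of the stochastic convolution itself, with
  variance of order `k⁻²` (`le_integral_highMode`, `le_modeVariance`).

Together the squared error is at least `(4 π² M²)⁻¹ + (64 π² N)⁻¹` (`le_integral_error_sq`), which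
is at least the square of the stated bound for all `M, N ≥ 1` (`rate_sq_le`).
-/

noncomputable section

namespace StochHeat

open Filter Topology

/-! ### The periodic heat kernel -/

theorem integrable_of_continuous {X E : Type*} [TopologicalSpace X] [CompactSpace X]
    [MeasurableSpace X] [OpensMeasurableSpace X] [NormedAddCommGroup E]
    [SecondCountableTopologyEither X E] {μ : Measure X} [IsFiniteMeasureOnCompacts μ] {f : X → E}
    (hf : Continuous f) : Integrable f μ :=
  hf.integrable_of_hasCompactSupport (HasCompactSupport.of_compactSpace f)

/-- The eigenvalue `4 π² n²` of `-Δ` on `𝕋` for the frequency `n`. -/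
def modeRate (n : ℤ) : ℝ := 4 * Real.pi ^ 2 * (n : ℝ) ^ 2

theorem modeRate_nonneg (n : ℤ) : 0 ≤ modeRate n := by unfold modeRate; positivity

theorem modeRate_pos {n : ℤ} (hn : n ≠ 0) : 0 < modeRate n := by
  have : (n : ℝ) ≠ 0 := by exact_mod_cast hn
  unfold modeRate; positivity

@[simp] theorem modeRate_zero : modeRate 0 = 0 := by simp [modeRate]

@[simp] theorem modeRate_neg (n : ℤ) : modeRate (-n) = modeRate n := by simp [modeRate]

instance : IsProbabilityMeasure (volume : Measure UnitAddCircle) :=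
  ⟨UnitAddCircle.measure_univ⟩

theorem haarAddCircle_eq_volume :
    (AddCircle.haarAddCircle : Measure UnitAddCircle) = volume := by
  have h := AddCircle.volume_eq_smul_haarAddCircle (T := 1)
  rw [ENNReal.ofReal_one, one_smul] at h
  exact h.symm

theorem summable_inv_modeRate : Summable fun n : ℤ => (modeRate n)⁻¹ := by
  have h := (Real.summable_one_div_int_pow (p := 2)).2 one_lt_two
  refine (h.mul_left (4 * Real.pi ^ 2)⁻¹).congr fun n => ?_
  simp [modeRate]; ring

theorem summable_exp_modeRate {r : ℝ} (hr : 0 < r) :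
    Summable fun n : ℤ => Real.exp (-(modeRate n * r)) := by
  refine Summable.of_norm_bounded_eventually (summable_inv_modeRate.mul_right r⁻¹) ?_
  filter_upwards [(Set.finite_singleton (0 : ℤ)).compl_mem_cofinite] with n hn
  have h := modeRate_pos hn
  rw [Real.norm_eq_abs, abs_of_pos (Real.exp_pos _), ← mul_inv, Real.exp_neg]
  refine inv_anti₀ (by positivity) ?_
  linarith [Real.add_one_le_exp (modeRate n * r)]

/-- The heat trace `∑ₖ exp(-4 π² k² r)`, the value of the heat kernel at the origin. -/
def heatTrace (r : ℝ) : ℝ := ∑' n : ℤ, Real.exp (-(modeRate n * r))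

theorem heatTrace_nonneg (r : ℝ) : 0 ≤ heatTrace r := tsum_nonneg fun _ => (Real.exp_pos _).le

/-- The heat kernel is the real part of a Fourier series whose sum is already real, by the symmetry
`n ↦ -n`. -/
theorem ofReal_heatKernel {r : ℝ} (x : UnitAddCircle) :
    (heatKernel r x : ℂ) = ∑' n : ℤ, (Real.exp (-(modeRate n * r)) : ℂ) * fourier n x := by
  have h0 : ∀ n : ℤ, Real.exp (-4 * Real.pi ^ 2 * (n : ℝ) ^ 2 * r)
      = Real.exp (-(modeRate n * r)) := fun n => by
    congr 1; unfold modeRate; ring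
  unfold heatKernel
  simp only [h0]
  rw [← Complex.conj_eq_iff_re, Complex.conj_tsum, ← (Equiv.neg ℤ).tsum_eq]
  refine tsum_congr fun n => ?_
  simp only [Equiv.neg_apply, map_mul, Complex.conj_ofReal, modeRate_neg, ← fourier_neg, neg_neg]

theorem norm_heatKernel_term (r : ℝ) (n : ℤ) (x : UnitAddCircle) :
    ‖(Real.exp (-(modeRate n * r)) : ℂ) * fourier n x‖ = Real.exp (-(modeRate n * r)) := by
  rw [norm_mul, fourier_apply, Circle.norm_coe, mul_one, Complex.norm_real, Real.norm_eq_abs,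
    abs_of_pos (Real.exp_pos _)]

theorem abs_heatKernel_le {r : ℝ} (hr : 0 < r) (x : UnitAddCircle) :
    |heatKernel r x| ≤ heatTrace r := by
  rw [← Real.norm_eq_abs, ← Complex.norm_real, ofReal_heatKernel]
  refine tsum_of_norm_bounded (summable_exp_modeRate hr).hasSum fun n => ?_
  rw [norm_heatKernel_term]

theorem continuousOn_heatKernel :
    ContinuousOn (fun z : ℝ × UnitAddCircle => heatKernel z.1 z.2) (Ioi 0 ×ˢ univ) := by
  have key : ContinuousOn (fun z : ℝ × UnitAddCircle => (heatKernel z.1 z.2 : ℂ))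
      (Ioi 0 ×ˢ univ) := by
    intro z hz
    have hz0 : 0 < z.1 := hz.1
    have h1 : ContinuousOn (fun z : ℝ × UnitAddCircle => (heatKernel z.1 z.2 : ℂ))
        (Ioi (z.1 / 2) ×ˢ univ) := by
      simp only [ofReal_heatKernel]
      refine continuousOn_tsum (u := fun n => Real.exp (-(modeRate n * (z.1 / 2)))) ?_
        (summable_exp_modeRate (by linarith)) ?_
      · intro n
        fun_prop
      · intro n w hw
        rw [norm_heatKernel_term]
        refine Real.exp_le_exp.2 (neg_le_neg ?_)
        exact mul_le_mul_of_nonneg_left (le_of_lt hw.1) (modeRate_nonneg n)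
    have hnhds : Ioi (z.1 / 2) ×ˢ univ ∈ 𝓝 z := by
      refine (isOpen_Ioi.prod isOpen_univ).mem_nhds (mk_mem_prod ?_ (mem_univ _))
      rw [mem_Ioi]; linarith
    exact (h1.continuousAt hnhds).continuousWithinAt
  have := Complex.continuous_re.comp_continuousOn key
  simpa [Function.comp_def] using this

theorem continuous_heatKernel {r : ℝ} (hr : 0 < r) : Continuous (heatKernel r) := by
  have hg : Continuous fun x : UnitAddCircle => ((r, x) : ℝ × UnitAddCircle) := by fun_prop
  exact continuousOn_heatKernel.comp_continuous hg fun x => mk_mem_prod hr (mem_univ x)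

theorem integral_fourier_mul_fourier (m n : ℤ) :
    ∫ x : UnitAddCircle, fourier m x * fourier n x = if m + n = 0 then 1 else 0 := by
  have h : ∀ k : ℤ, ∫ x : UnitAddCircle, fourier k x = if k = 0 then 1 else 0 := by
    intro k
    split_ifs with hk
    · simp [hk]
    · exact integral_eq_zero_of_add_right_eq_neg (fourier_add_half_inv_index hk one_pos)
  rw [← h]
  refine integral_congr_ae (Eventually.of_forall fun x => ?_)
  simp

/-- The characters are eigenfunctions of convolution with the heat kernel. -/
theorem integral_heatKernel_fourier {r : ℝ} (hr : 0 < r) (y : UnitAddCircle) (n : ℤ) :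
    ∫ x : UnitAddCircle, (heatKernel r (x - y) : ℂ) * fourier n x
      = Real.exp (-(modeRate n * r)) * fourier n y := by
  have hterm : ∀ (m : ℤ) (x : UnitAddCircle),
      (Real.exp (-(modeRate m * r)) : ℂ) * fourier m (x - y) * fourier n x
        = (Real.exp (-(modeRate m * r)) : ℂ) * fourier (-m) y * (fourier m x * fourier n x) := by
    intro m x
    have : fourier m (x - y) = fourier m x * fourier (-m) y := by
      simp [fourier_apply, sub_eq_add_neg, smul_add, AddCircle.toCircle_add]
    rw [this]; ring
  have hI : ∀ (m : ℤ) (x : UnitAddCircle), ‖(Real.exp (-(modeRate m * r)) : ℂ)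
      * fourier m (x - y) * fourier n x‖ = Real.exp (-(modeRate m * r)) := by
    intro m x
    rw [norm_mul, norm_heatKernel_term, fourier_apply, Circle.norm_coe, mul_one]
  have hs := hasSum_integral_of_summable_integral_norm
    (F := fun (m : ℤ) (x : UnitAddCircle) =>
      (Real.exp (-(modeRate m * r)) : ℂ) * fourier m (x - y) * fourier n x) (μ := volume)
    (fun m => integrable_of_continuous (by fun_prop))
    (by simpa only [hI, integral_const, probReal_univ, one_smul] using summable_exp_modeRate hr)
  simp only [hterm, integral_const_mul, integral_fourier_mul_fourier] at hs
  have hs2 := hs.unique (hasSum_single (-n) fun m hm => by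
    rw [if_neg (by omega), mul_zero])
  rw [neg_add_cancel, if_pos rfl, mul_one, neg_neg, modeRate_neg] at hs2
  rw [← hs2]
  refine integral_congr_ae (Eventually.of_forall fun x => ?_)
  simp only [← hterm, ofReal_heatKernel, tsum_mul_right]

/-- `f` is an eigenfunction of every heat operator `P_r`, `r > 0`, with eigenvalue `exp(-l r)`. -/
def IsHeatEigen (f : C(UnitAddCircle, ℝ)) (l : ℝ) : Prop :=
  ∀ r, 0 < r → ∀ y, ∫ x, heatKernel r (x - y) * f x = Real.exp (-(l * r)) * f y

/-- The function `x ↦ cos (2 π n x)` on `𝕋`. -/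
def cosMode (n : ℤ) : C(UnitAddCircle, ℝ) := ⟨fun x => (fourier n x).re, by fun_prop⟩

/-- The function `x ↦ sin (2 π n x)` on `𝕋`. -/
def sinMode (n : ℤ) : C(UnitAddCircle, ℝ) := ⟨fun x => (fourier n x).im, by fun_prop⟩

@[simp] theorem cosMode_apply (n : ℤ) (x : UnitAddCircle) : cosMode n x = (fourier n x).re := rfl

@[simp] theorem sinMode_apply (n : ℤ) (x : UnitAddCircle) : sinMode n x = (fourier n x).im := rfl

theorem integrable_heatKernel_fourier {r : ℝ} (hr : 0 < r) (y : UnitAddCircle) (n : ℤ) :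
    Integrable (fun x : UnitAddCircle => (heatKernel r (x - y) : ℂ) * fourier n x) := by
  have := continuous_heatKernel hr
  exact integrable_of_continuous (by fun_prop)

theorem isHeatEigen_cosMode (n : ℤ) : IsHeatEigen (cosMode n) (modeRate n) := by
  intro r hr y
  have h := congrArg Complex.re (integral_heatKernel_fourier hr y n)
  rw [Complex.re_ofReal_mul, ← RCLike.re_eq_complex_re,
    ← integral_re (integrable_heatKernel_fourier hr y n)] at h
  simpa using h

theorem isHeatEigen_sinMode (n : ℤ) : IsHeatEigen (sinMode n) (modeRate n) := by
  intro r hr y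
  have h := congrArg Complex.im (integral_heatKernel_fourier hr y n)
  rw [Complex.im_ofReal_mul, ← RCLike.im_eq_complex_im,
    ← integral_im (integrable_heatKernel_fourier hr y n)] at h
  simpa using h

/-- Parseval, in the form `p_r * p_r = p_{2r}` evaluated at the origin. -/
theorem integral_heatKernel_sq {r : ℝ} (hr : 0 < r) (x : UnitAddCircle) :
    ∫ y, heatKernel r (x - y) ^ 2 = heatTrace (2 * r) := by
  rw [integral_sub_left_eq_self (fun z => heatKernel r z ^ 2) volume x]
  have hc := continuous_heatKernel hr
  have hI : ∀ (m : ℤ) (x : UnitAddCircle), ‖(Real.exp (-(modeRate m * r)) : ℂ)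
      * fourier m x * heatKernel r x‖ = Real.exp (-(modeRate m * r)) * |heatKernel r x| := by
    intro m x
    rw [norm_mul, norm_heatKernel_term, Complex.norm_real, Real.norm_eq_abs]
  have hs := hasSum_integral_of_summable_integral_norm
    (F := fun (m : ℤ) (x : UnitAddCircle) =>
      (Real.exp (-(modeRate m * r)) : ℂ) * fourier m x * heatKernel r x) (μ := volume)
    (fun m => integrable_of_continuous (by fun_prop))
    (by simpa only [hI, integral_const_mul] using (summable_exp_modeRate hr).mul_right _)
  have h1 : ∀ m : ℤ, ∫ x : UnitAddCircle, (Real.exp (-(modeRate m * r)) : ℂ) * fourier m x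
      * heatKernel r x = (Real.exp (-(modeRate m * (2 * r))) : ℂ) := by
    intro m
    have := integral_heatKernel_fourier hr 0 m
    simp only [sub_zero] at this
    simp only [mul_assoc, integral_const_mul, mul_comm (fourier m _) (heatKernel r _ : ℂ), this]
    rw [fourier_eval_zero, mul_one, ← Complex.ofReal_mul, ← Real.exp_add]
    congr 2; ring
  simp only [h1] at hs
  have h2 : (∑' m : ℤ, (Real.exp (-(modeRate m * (2 * r))) : ℂ)) = (heatTrace (2 * r) : ℂ) := by
    rw [heatTrace, Complex.ofReal_tsum]
  have h3 := hs.tsum_eq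
  rw [h2] at h3
  apply Complex.ofReal_injective
  rw [h3, ← integral_complex_ofReal]
  refine integral_congr_ae (Eventually.of_forall fun x => ?_)
  simp only [tsum_mul_right, ← ofReal_heatKernel]
  push_cast; ring

theorem lintegral_exp_le {l : ℝ} (hl : 0 < l) (t : ℝ) :
    ∫⁻ r in Ioc 0 t, ENNReal.ofReal (Real.exp (-(l * r))) ≤ ENNReal.ofReal l⁻¹ := by
  have hi : IntegrableOn (fun r : ℝ => Real.exp (-(l * r))) (Ioi 0) := by
    simpa only [neg_mul] using integrableOn_exp_mul_Ioi (neg_lt_zero.2 hl) 0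
  calc ∫⁻ r in Ioc 0 t, ENNReal.ofReal (Real.exp (-(l * r)))
      ≤ ∫⁻ r in Ioi 0, ENNReal.ofReal (Real.exp (-(l * r))) :=
        lintegral_mono_set Ioc_subset_Ioi_self
    _ = ENNReal.ofReal (∫ r in Ioi 0, Real.exp (-(l * r))) :=
        (ofReal_integral_eq_lintegral_ofReal hi
          (Eventually.of_forall fun _ => (Real.exp_pos _).le)).symm
    _ = ENNReal.ofReal l⁻¹ := by
        have := integral_exp_mul_Ioi (neg_lt_zero.2 hl) 0
        simp only [neg_mul] at this
        rw [this]; simp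

/-- The heat trace is of order `r^{-1/2}` near `0`; only its integrability is needed, and this follows
term by term from `∑ 1 / modeRate n < ∞`. It makes the heat kernel square-integrable in space and
time, and the mild equation amenable to Fubini. -/
theorem lintegral_heatTrace_lt_top (t : ℝ) :
    ∫⁻ r in Ioc 0 t, ENNReal.ofReal (heatTrace r) < ∞ := by
  have h1 : ∫⁻ r in Ioc 0 t, ENNReal.ofReal (heatTrace r)
      = ∑' n : ℤ, ∫⁻ r in Ioc 0 t, ENNReal.ofReal (Real.exp (-(modeRate n * r))) := by
    rw [← lintegral_tsum fun n => by fun_prop]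
    refine setLIntegral_congr_fun measurableSet_Ioc fun r hr => ?_
    rw [heatTrace, ENNReal.ofReal_tsum_of_nonneg (fun _ => (Real.exp_pos _).le)
      (summable_exp_modeRate hr.1)]
  have h2 : ∀ n : ℤ, ∫⁻ r in Ioc 0 t, ENNReal.ofReal (Real.exp (-(modeRate n * r)))
      ≤ (if n = 0 then ENNReal.ofReal t else 0) + ENNReal.ofReal (modeRate n)⁻¹ := by
    intro n
    split_ifs with hn
    · simp [hn]
    · rw [zero_add]
      exact lintegral_exp_le (modeRate_pos hn) t
  rw [h1]
  refine (ENNReal.tsum_le_tsum h2).trans_lt ?_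
  rw [ENNReal.tsum_add, tsum_ite_eq]
  refine ENNReal.add_lt_top.2 ⟨ENNReal.ofReal_lt_top, ?_⟩
  rw [← ENNReal.ofReal_tsum_of_nonneg (fun n => inv_nonneg.2 (modeRate_nonneg n))
    summable_inv_modeRate]
  exact ENNReal.ofReal_lt_top

/-! ### Wiener integrals are jointly Gaussian -/

section Wiener

variable {Ω : Type*} [MeasurableSpace Ω] {P : Measure Ω} {T : ℝ} {ξ : CylSet T → Lp ℝ 2 P}

theorem IsWhiteNoise.inner_wienerIntegral (hξ : IsWhiteNoise ξ) (g h : Lp ℝ 2 (cylMeasure T)) :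
    inner ℝ (wienerIntegral ξ g) (wienerIntegral ξ h) = inner ℝ g h :=
  LinearIsometry.inner_map_map
    ({ toLinearMap := (wienerIntegral ξ).toLinearMap
       norm_map' := hξ.norm_wienerIntegral } : Lp ℝ 2 (cylMeasure T) →ₗᵢ[ℝ] Lp ℝ 2 P) g h

theorem eLpNorm_two_sq {α E : Type*} [MeasurableSpace α] [NormedAddCommGroup E] {μ : Measure α}
    (f : α → E) : eLpNorm f 2 μ ^ 2 = ∫⁻ x, ‖f x‖ₑ ^ 2 ∂μ := by
  have h := eLpNorm_nnreal_pow_eq_lintegral (f := f) (μ := μ) (p := 2) two_ne_zero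
  simpa using h

theorem integral_abs_le_norm [IsProbabilityMeasure P] (X : Lp ℝ 2 P) : ∫ ω, |X ω| ∂P ≤ ‖X‖ := by
  have h := eLpNorm_le_eLpNorm_of_exponent_le (μ := P) (p := 1) (q := 2) (f := X) (by norm_num)
    (Lp.memLp X).aestronglyMeasurable
  rw [Lp.norm_def]
  have h1 : ∫ ω, |X ω| ∂P = (eLpNorm X 1 P).toReal := by
    rw [eLpNorm_one_eq_lintegral_enorm, ← integral_norm_eq_lintegral_enorm
      (Lp.memLp X).aestronglyMeasurable]
    simp
  rw [h1]
  exact ENNReal.toReal_mono (Lp.eLpNorm_ne_top X) h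

/-- Characteristic functions depend continuously on the variable in `L²`, so a formula for the
characteristic functions of a dense set of Wiener integrals extends to all of them. -/
theorem charFun_wiener_lipschitz [IsProbabilityMeasure P] (t : ℝ) (X Y : Lp ℝ 2 P) :
    ‖charFun (P.map X) t - charFun (P.map Y) t‖ ≤ |t| * ‖X - Y‖ := by
  have hX := (Lp.memLp X).aestronglyMeasurable.aemeasurable
  have hY := (Lp.memLp Y).aestronglyMeasurable.aemeasurable
  have hi : ∀ Z : Lp ℝ 2 P, Integrable (fun ω => Complex.exp (t * Z ω * Complex.I)) P := by
    intro Z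
    have hZ := (Lp.memLp Z).aestronglyMeasurable.aemeasurable
    refine Integrable.of_bound (C := 1) (by fun_prop) (Eventually.of_forall fun ω => ?_)
    rw [← Complex.ofReal_mul, Complex.norm_exp_ofReal_mul_I]
  have hc : ∀ Z : Lp ℝ 2 P, charFun (P.map Z) t = ∫ ω, Complex.exp (t * Z ω * Complex.I) ∂P := by
    intro Z
    rw [charFun_apply_real,
      integral_map (Lp.memLp Z).aestronglyMeasurable.aemeasurable (by fun_prop)]
  rw [hc, hc, ← integral_sub (hi X) (hi Y)]
  refine (norm_integral_le_integral_norm _).trans ?_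
  have hd : Integrable (fun ω => |(X - Y : Lp ℝ 2 P) ω|) P :=
    ((Lp.memLp (X - Y)).integrable (by norm_num)).abs
  refine le_trans ?_ (mul_le_mul_of_nonneg_left (integral_abs_le_norm (X - Y)) (abs_nonneg t))
  rw [← integral_const_mul]
  refine integral_mono_ae ((hi X).sub (hi Y)).norm (hd.const_mul _) ?_
  filter_upwards [Lp.coeFn_sub X Y] with ω hω
  rw [hω, Pi.sub_apply, ← abs_mul]
  have h1 : Complex.exp (t * X ω * Complex.I) - Complex.exp (t * Y ω * Complex.I)
      = Complex.exp ((t * Y ω : ℝ) * Complex.I)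
        * (Complex.exp (Complex.I * (t * (X ω - Y ω) : ℝ)) - 1) := by
    rw [mul_sub, mul_one, ← Complex.exp_add]
    push_cast
    ring_nf
  rw [h1, norm_mul, Complex.norm_exp_ofReal_mul_I, one_mul]
  exact Real.norm_exp_I_mul_ofReal_sub_one_le

theorem IsWhiteNoise.integral_wienerIntegral [IsProbabilityMeasure P] (hξ : IsWhiteNoise ξ)
    (g : Lp ℝ 2 (cylMeasure T)) : ∫ ω, wienerIntegral ξ g ω ∂P = 0 := by
  have hint : ∀ X : Lp ℝ 2 P, ∫ ω, X ω ∂P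
      = inner ℝ (indicatorConstLp 2 MeasurableSet.univ (measure_ne_top P univ) (1 : ℝ)) X := by
    intro X
    rw [L2.inner_indicatorConstLp_one, setIntegral_univ]
  rw [hint]
  refine denseRange_cylIndicator.induction (P := fun g => inner ℝ
    (indicatorConstLp 2 MeasurableSet.univ (measure_ne_top P univ) (1 : ℝ))
    (wienerIntegral ξ g) = 0) ?_ (isClosed_eq (by fun_prop) (by fun_prop)) g
  rintro _ ⟨v, rfl⟩
  simp only [Finsupp.linearCombination_apply, Finsupp.sum, map_sum, map_smul, inner_sum,
    real_inner_smul_right, hξ.wienerIntegral_indicator]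
  refine Finset.sum_eq_zero fun A _ => ?_
  rw [← hint, hξ.mean_zero, mul_zero]

theorem IsWhiteNoise.hasGaussianLaw_linearCombination (hξ : IsWhiteNoise ξ)
    (v : CylSet T →₀ ℝ) : HasGaussianLaw (Finsupp.linearCombination ℝ ξ v : Lp ℝ 2 P) P := by
  have h := (hξ.gaussian.smul v).hasGaussianLaw_fun_sum (I := v.support)
  refine h.congr ?_
  rw [Finsupp.linearCombination_apply, Finsupp.sum]
  have h2 : ∀ᵐ ω ∂P, ∀ A ∈ v.support, (v A • ξ A : Lp ℝ 2 P) ω = v A • ξ A ω :=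
    (ae_ball_iff v.support.countable_toSet).2 fun A _ => Lp.coeFn_smul (v A) (ξ A)
  filter_upwards [Lp.coeFn_finsetSum v.support (fun A => v A • ξ A), h2] with ω h3 h4
  rw [h3, Finset.sum_apply]
  exact (Finset.sum_congr rfl fun A hA => h4 A hA).symm

/-- On linear combinations of indicators this is the Gaussian law of the noise; the general case
follows by density. -/
theorem IsWhiteNoise.charFun_wienerIntegral [IsProbabilityMeasure P] (hξ : IsWhiteNoise ξ)
    (g : Lp ℝ 2 (cylMeasure T)) (t : ℝ) :
    charFun (P.map (wienerIntegral ξ g)) t = Complex.exp (-(‖g‖ ^ 2 * t ^ 2 / 2 : ℝ)) := by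
  have hcont : Continuous fun X : Lp ℝ 2 P => charFun (P.map X) t := by
    refine (LipschitzWith.of_dist_le_mul (K := ‖t‖₊) fun X Y => ?_).continuous
    rw [dist_eq_norm, dist_eq_norm, coe_nnnorm, Real.norm_eq_abs]
    exact charFun_wiener_lipschitz t X Y
  refine denseRange_cylIndicator.induction (P := fun g =>
    charFun (P.map (wienerIntegral ξ g)) t = Complex.exp (-(‖g‖ ^ 2 * t ^ 2 / 2 : ℝ))) ?_
    (isClosed_eq (hcont.comp (wienerIntegral ξ).continuous) (by fun_prop)) g
  rintro _ ⟨v, rfl⟩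
  have hW : wienerIntegral ξ (Finsupp.linearCombination ℝ cylIndicator v)
      = Finsupp.linearCombination ℝ ξ v := by
    simp only [Finsupp.linearCombination_apply, Finsupp.sum, map_sum, map_smul,
      hξ.wienerIntegral_indicator]
  have h0 := hξ.integral_wienerIntegral (Finsupp.linearCombination ℝ cylIndicator v)
  rw [hW] at h0 ⊢
  have hv : Var[(Finsupp.linearCombination ℝ ξ v : Lp ℝ 2 P); P]
      = ‖Finsupp.linearCombination ℝ cylIndicator v‖ ^ 2 := by
    rw [variance_of_integral_eq_zero (Lp.memLp _).aestronglyMeasurable.aemeasurable h0,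
      ← hξ.norm_linearCombination, ← real_inner_self_eq_norm_sq, L2.inner_def]
    simp [pow_two]
  rw [(hξ.hasGaussianLaw_linearCombination v).map_eq_gaussianReal, charFun_gaussianReal, h0, hv,
    Real.coe_toNNReal _ (by positivity)]
  push_cast
  ring_nf

theorem IsWhiteNoise.hasGaussianLaw_wienerIntegral [IsProbabilityMeasure P] (hξ : IsWhiteNoise ξ)
    (g : Lp ℝ 2 (cylMeasure T)) : HasGaussianLaw (wienerIntegral ξ g) P := by
  have hm := (Lp.memLp (wienerIntegral ξ g)).aestronglyMeasurable.aemeasurable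
  have : P.map (wienerIntegral ξ g) = gaussianReal 0 (‖g‖₊ ^ 2) := by
    have := Measure.isProbabilityMeasure_map hm
    refine Measure.ext_of_charFun (funext fun t => ?_)
    rw [hξ.charFun_wienerIntegral, charFun_gaussianReal]
    push_cast
    simp
  exact ⟨by rw [this]; infer_instance⟩

/-- All finite-dimensional marginals of a family of Wiener integrals are Gaussian, because every
linear functional of such a marginal is again a Wiener integral. -/
theorem IsWhiteNoise.isGaussianProcess_wienerIntegral [IsProbabilityMeasure P]
    (hξ : IsWhiteNoise ξ) {ι : Type*} (g : ι → Lp ℝ 2 (cylMeasure T)) :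
    IsGaussianProcess (fun i ω => wienerIntegral ξ (g i) ω) P := by
  classical
  refine ⟨fun I => ⟨isGaussian_of_isGaussian_map fun L => ?_⟩⟩
  have hm : ∀ i, AEMeasurable (wienerIntegral ξ (g i)) P :=
    fun i => (Lp.memLp _).aestronglyMeasurable.aemeasurable
  have hmI : AEMeasurable (fun ω => I.restrict fun i => wienerIntegral ξ (g i) ω) P :=
    aemeasurable_pi_lambda _ fun i => hm i
  rw [AEMeasurable.map_map_of_aemeasurable (by fun_prop) hmI]
  set c : I → ℝ := fun i => L (Pi.single i 1) with hc
  have hL : ∀ x : I → ℝ, L x = ∑ i, c i * x i := by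
    intro x
    conv_lhs => rw [← Finset.univ_sum_single x]
    rw [map_sum]
    refine Finset.sum_congr rfl fun i _ => ?_
    have : Pi.single i (x i) = x i • (Pi.single i (1 : ℝ) : I → ℝ) := by
      rw [← Pi.single_smul, smul_eq_mul, mul_one]
    rw [this, map_smul, smul_eq_mul, mul_comm]
  have hG := hξ.hasGaussianLaw_wienerIntegral (∑ i, c i • g i)
  refine (hG.congr ?_).isGaussian_map
  rw [map_sum]
  have h2 : ∀ᵐ ω ∂P, ∀ i : I, wienerIntegral ξ (c i • g i) ω = c i * wienerIntegral ξ (g i) ω := by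
    rw [ae_all_iff]
    intro i
    rw [map_smul]
    exact Lp.coeFn_smul (c i) _
  filter_upwards [Lp.coeFn_finsetSum Finset.univ (fun i : I => wienerIntegral ξ (c i • g i)), h2]
    with ω h3 h4
  rw [h3, Finset.sum_apply, Function.comp_apply, hL]
  exact Finset.sum_congr rfl fun i _ => h4 i

theorem noiseIntegral_of_memLp {g : ℝ × UnitAddCircle → ℝ} (hg : MemLp g 2 (cylMeasure T)) :
    noiseIntegral ξ g = wienerIntegral ξ (hg.toLp g) := dif_pos hg

theorem IsWhiteNoise.integral_noiseIntegral_mul (hξ : IsWhiteNoise ξ)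
    {g h : ℝ × UnitAddCircle → ℝ} (hg : MemLp g 2 (cylMeasure T)) (hh : MemLp h 2 (cylMeasure T)) :
    ∫ ω, noiseIntegral ξ g ω * noiseIntegral ξ h ω ∂P = ∫ z, g z * h z ∂cylMeasure T := by
  rw [noiseIntegral_of_memLp hg, noiseIntegral_of_memLp hh]
  have h1 := hξ.inner_wienerIntegral (hg.toLp g) (hh.toLp h)
  rw [L2.inner_def, L2.inner_def] at h1
  simp only [RCLike.inner_apply, conj_trivial, mul_comm] at h1
  rw [h1]
  refine integral_congr_ae ?_
  filter_upwards [hg.coeFn_toLp, hh.coeFn_toLp] with z h1 h2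
  rw [h1, h2]

theorem IsWhiteNoise.lintegral_noiseIntegral_sq (hξ : IsWhiteNoise ξ)
    {g : ℝ × UnitAddCircle → ℝ} (hg : MemLp g 2 (cylMeasure T)) :
    ∫⁻ ω, ‖noiseIntegral ξ g ω‖ₑ ^ 2 ∂P = ∫⁻ z, ‖g z‖ₑ ^ 2 ∂cylMeasure T := by
  have h1 : eLpNorm (noiseIntegral ξ g) 2 P = eLpNorm g 2 (cylMeasure T) := by
    have h := hξ.norm_wienerIntegral (hg.toLp g)
    rw [← noiseIntegral_of_memLp hg, Lp.norm_toLp, Lp.norm_def] at h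
    exact (ENNReal.toReal_eq_toReal_iff' (Lp.eLpNorm_ne_top _) hg.eLpNorm_ne_top).1 h
  rw [← eLpNorm_two_sq, h1, eLpNorm_two_sq]

end Wiener

/-- Noise integrals whose integrands are orthogonal to those of a family of noise integrals have
vanishing conditional expectation given that family: jointly Gaussian uncorrelated variables are
independent. -/
theorem IsWhiteNoise.condExp_noiseIntegral_eq_zero {Ω : Type*} {G : MeasurableSpace Ω}
    [mΩ : MeasurableSpace Ω] {P : Measure Ω} {T : ℝ} {ξ : CylSet T → Lp ℝ 2 P}
    [IsProbabilityMeasure P]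
    (hξ : IsWhiteNoise ξ) {ι : Type*} {g : ℝ × UnitAddCircle → ℝ}
    (hg : MemLp g 2 (cylMeasure T)) {h : ι → ℝ × UnitAddCircle → ℝ}
    (hh : ∀ i, MemLp (h i) 2 (cylMeasure T)) (hgh : ∀ i, ∫ z, g z * h i z ∂cylMeasure T = 0)
    {V : ι → Ω → ℝ} (hVm : ∀ i, Measurable (V i)) (hV : ∀ i, V i =ᵐ[P] noiseIntegral ξ (h i))
    (hG : G ≤ MeasurableSpace.comap (fun ω i => V i ω) inferInstance) :
    P[noiseIntegral ξ g | G] =ᵐ[P] 0 := by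
  have hVm' : Measurable fun ω i => V i ω := measurable_pi_lambda _ hVm
  have hW : StronglyMeasurable (noiseIntegral ξ g : Ω → ℝ) := Lp.stronglyMeasurable _
  have hint : ∀ f : ℝ × UnitAddCircle → ℝ, MemLp f 2 (cylMeasure T) →
      ∫ ω, noiseIntegral ξ f ω ∂P = 0 := fun f hf => by
    rw [noiseIntegral_of_memLp hf, hξ.integral_wienerIntegral]
  have hproc : IsGaussianProcess (Sum.elim (fun (_ : Unit) ω => noiseIntegral ξ g ω) V) P := by
    refine (hξ.isGaussianProcess_wienerIntegral
      (Sum.elim (fun _ : Unit => hg.toLp g) fun i => (hh i).toLp (h i))).congr ?_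
    rintro (_ | i)
    · rw [Sum.elim_inl, Sum.elim_inl, noiseIntegral_of_memLp hg]
    · rw [Sum.elim_inr, Sum.elim_inr, ← noiseIntegral_of_memLp (hh i)]
      exact (hV i).symm
  have hind := hproc.indepFun_of_covariance_eq_zero (fun _ => hW.measurable.aemeasurable)
    (fun i => (hVm i).aemeasurable) (fun _ i => by
      have hVi : MemLp (V i) 2 P := (Lp.memLp (noiseIntegral ξ (h i))).ae_eq (hV i).symm
      rw [covariance_eq_sub (Lp.memLp _) hVi, hint g hg, zero_mul, sub_zero, ← hgh i,
        ← hξ.integral_noiseIntegral_mul hg (hh i)]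
      refine integral_congr_ae ?_
      filter_upwards [hV i] with ω hω
      rw [Pi.mul_apply, hω])
  have hind2 : IndepFun (noiseIntegral ξ g : Ω → ℝ) (fun ω i => V i ω) P :=
    hind.comp (φ := fun x : Unit → ℝ => x ()) (measurable_pi_apply _) measurable_id
  have hind3 := indep_of_indep_of_le_right ((IndepFun_iff_Indep _ _ _).1 hind2) hG
  have h := condExp_indep_eq hW.measurable.comap_le (hG.trans hVm'.comap_le)
    (comap_measurable _).stronglyMeasurable hind3
  rw [hint g hg] at h
  exact h

/-! ### Fourier modes of the stochastic convolution -/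

theorem memLp_two_of_lintegral_lt_top {α E : Type*} [MeasurableSpace α] [NormedAddCommGroup E]
    {μ : Measure α} {f : α → E} (hf : AEStronglyMeasurable f μ) (h : ∫⁻ x, ‖f x‖ₑ ^ 2 ∂μ < ∞) :
    MemLp f 2 μ := by
  refine ⟨hf, ?_⟩
  rw [← eLpNorm_two_sq] at h
  exact (ENNReal.pow_lt_top_iff.1 h).resolve_right two_ne_zero

/-- A function on a product is square-integrable if its slices are, uniformly. -/
theorem memLp_two_prod {α β : Type*} [MeasurableSpace α] [MeasurableSpace β] {μ : Measure α}
    {ν : Measure β} [IsFiniteMeasure μ] [SFinite ν] {f : α × β → ℝ}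
    (hf : AEStronglyMeasurable f (μ.prod ν)) {C : ℝ≥0∞} (hC : C < ∞)
    (h : ∀ᵐ x ∂μ, ∫⁻ y, ‖f (x, y)‖ₑ ^ 2 ∂ν ≤ C) : MemLp f 2 (μ.prod ν) := by
  refine memLp_two_of_lintegral_lt_top hf ?_
  rw [lintegral_prod _ (hf.enorm.pow_const 2)]
  refine (lintegral_mono_ae h).trans_lt ?_
  rw [lintegral_const]
  exact ENNReal.mul_lt_top hC (measure_lt_top μ univ)

/-- The integrand `(s, y) ↦ 1_{s < t} p_{t-s}(x - y)` of the stochastic convolution. -/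
def convKernel (t : ℝ) (x : UnitAddCircle) (z : ℝ × UnitAddCircle) : ℝ :=
  (Iio t).indicator (fun s => heatKernel (t - s) (x - z.2)) z.1

theorem measurable_convKernel (t : ℝ) :
    Measurable fun w : UnitAddCircle × (ℝ × UnitAddCircle) => convKernel t w.1 w.2 := by
  classical
  have h1 : Measurable ((Ioi (0 : ℝ) ×ˢ (univ : Set UnitAddCircle)).indicator
      fun z : ℝ × UnitAddCircle => heatKernel z.1 z.2) := by
    rw [← piecewise_eq_indicator]
    exact continuousOn_heatKernel.measurable_piecewise continuousOn_const
      (measurableSet_Ioi.prod MeasurableSet.univ)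
  have h2 : Measurable fun w : UnitAddCircle × (ℝ × UnitAddCircle) =>
      ((t - w.2.1, w.1 - w.2.2) : ℝ × UnitAddCircle) := by fun_prop
  convert! h1.comp h2 using 2 with w
  by_cases h : w.2.1 < t <;> simp [convKernel, indicator, h]

theorem measurable_convKernel_right (t : ℝ) (x : UnitAddCircle) : Measurable (convKernel t x) := by
  exact Measurable.of_uncurry_left (f := convKernel t) (measurable_convKernel t)

theorem heatTrace_le {r s : ℝ} (hr : 0 < r) (hrs : r ≤ s) : heatTrace s ≤ heatTrace r :=
  (summable_exp_modeRate (hr.trans_le hrs)).tsum_le_tsum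
    (fun n => Real.exp_le_exp.2 (neg_le_neg (mul_le_mul_of_nonneg_left hrs (modeRate_nonneg n))))
    (summable_exp_modeRate hr)

theorem cylMeasure_eq_prod (T : ℝ) :
    cylMeasure T = (volume.restrict (Icc 0 T)).prod (volume : Measure UnitAddCircle) := by
  rw [cylMeasure, Measure.volume_eq_prod, ← Measure.prod_restrict, Measure.restrict_univ]

/-- The variance of the stochastic convolution at a point is at most the integrated heat trace. -/
theorem lintegral_convKernel_sq_le (T t : ℝ) (x : UnitAddCircle) :
    ∫⁻ z, ‖convKernel t x z‖ₑ ^ 2 ∂cylMeasure T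
      ≤ ∫⁻ r in Ioc 0 t, ENNReal.ofReal (heatTrace r) := by
  have hm := measurable_convKernel_right t x
  have hin : ∀ s, 0 ≤ s → ∫⁻ y, ‖convKernel t x (s, y)‖ₑ ^ 2
      ≤ (Ioc 0 t).indicator (fun r => ENNReal.ofReal (heatTrace r)) (t - s) := by
    intro s hs
    by_cases hst : s < t
    · have hr : 0 < t - s := sub_pos.2 hst
      have hc := continuous_heatKernel hr
      rw [indicator_of_mem (show t - s ∈ Ioc 0 t from ⟨hr, by linarith⟩)]
      have h1 : ∀ y, ‖convKernel t x (s, y)‖ₑ ^ 2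
          = ENNReal.ofReal (heatKernel (t - s) (x - y) ^ 2) := by
        intro y
        rw [convKernel, indicator_of_mem (by exact hst), ← ofReal_norm,
          ← ENNReal.ofReal_pow (norm_nonneg _), Real.norm_eq_abs, sq_abs]
      simp only [h1]
      rw [← ofReal_integral_eq_lintegral_ofReal (integrable_of_continuous (by fun_prop))
        (Eventually.of_forall fun y => sq_nonneg _), integral_heatKernel_sq hr]
      exact ENNReal.ofReal_le_ofReal (heatTrace_le hr (by linarith))
    · have h1 : ∀ y, convKernel t x (s, y) = 0 := fun y => indicator_of_notMem (by exact hst) _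
      simp [h1]
  rw [cylMeasure_eq_prod, lintegral_prod _ (by fun_prop)]
  calc ∫⁻ s in Icc 0 T, ∫⁻ y, ‖convKernel t x (s, y)‖ₑ ^ 2
      ≤ ∫⁻ s in Icc 0 T, (Ioc 0 t).indicator (fun r => ENNReal.ofReal (heatTrace r)) (t - s) :=
        setLIntegral_mono' measurableSet_Icc fun s hs => hin s hs.1
    _ ≤ ∫⁻ s, (Ioc 0 t).indicator (fun r => ENNReal.ofReal (heatTrace r)) (t - s) :=
        setLIntegral_le_lintegral _ _
    _ = ∫⁻ r, (Ioc 0 t).indicator (fun r => ENNReal.ofReal (heatTrace r)) r :=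
        lintegral_sub_left_eq_self _ t
    _ = _ := lintegral_indicator measurableSet_Ioc _

theorem memLp_convKernel (T t : ℝ) (x : UnitAddCircle) :
    MemLp (convKernel t x) 2 (cylMeasure T) := by
  have hm := measurable_convKernel_right t x
  exact memLp_two_of_lintegral_lt_top hm.aestronglyMeasurable
    ((lintegral_convKernel_sq_le T t x).trans_lt (lintegral_heatTrace_lt_top t))

/-- The product integrand `(s, y) ↦ φ(s) f(y)`. -/
def tensor (φ : ℝ → ℝ) (f : C(UnitAddCircle, ℝ)) (z : ℝ × UnitAddCircle) : ℝ := φ z.1 * f z.2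

theorem memLp_tensor {T : ℝ} {φ : ℝ → ℝ} (hφ : MemLp φ 2 (volume.restrict (Icc 0 T)))
    (f : C(UnitAddCircle, ℝ)) : MemLp (tensor φ f) 2 (cylMeasure T) := by
  have hf : MemLp f 2 (volume : Measure UnitAddCircle) :=
    MemLp.of_bound f.continuous.aestronglyMeasurable ‖f‖ (Eventually.of_forall f.norm_coe_le_norm)
  rw [cylMeasure_eq_prod]
  refine memLp_two_of_lintegral_lt_top
    (hφ.aestronglyMeasurable.comp_fst.mul hf.aestronglyMeasurable.comp_snd) ?_
  simp only [tensor, enorm_mul, mul_pow]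
  rw [lintegral_prod_mul (hφ.aestronglyMeasurable.enorm.pow_const 2)
    (hf.aestronglyMeasurable.enorm.pow_const 2), ← eLpNorm_two_sq, ← eLpNorm_two_sq]
  exact ENNReal.mul_lt_top (ENNReal.pow_lt_top hφ.2) (ENNReal.pow_lt_top hf.2)

theorem integral_tensor_mul_tensor (T : ℝ) (φ ψ : ℝ → ℝ) (f g : C(UnitAddCircle, ℝ)) :
    ∫ z, tensor φ f z * tensor ψ g z ∂cylMeasure T
      = (∫ s in Icc 0 T, φ s * ψ s) * ∫ y, f y * g y := by
  rw [cylMeasure_eq_prod, ← integral_prod_mul]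
  refine integral_congr_ae (Eventually.of_forall fun z => ?_)
  simp only [tensor]; ring

/-- The weight `s ↦ 1_{s < t} exp(-l (t - s))`. -/
def decay (l t : ℝ) : ℝ → ℝ := (Iio t).indicator fun s => Real.exp (-(l * (t - s)))

theorem measurable_decay (l t : ℝ) : Measurable (decay l t) :=
  Measurable.indicator (by fun_prop) measurableSet_Iio

theorem decay_nonneg (l t s : ℝ) : 0 ≤ decay l t s :=
  indicator_nonneg (fun _ _ => (Real.exp_pos _).le) s

theorem decay_le_one {l : ℝ} (hl : 0 ≤ l) (t s : ℝ) : decay l t s ≤ 1 := by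
  refine indicator_le' (fun s hs => ?_) (fun _ _ => zero_le_one) s
  rw [Real.exp_le_one_iff, neg_nonpos]
  exact mul_nonneg hl (sub_nonneg.2 (le_of_lt hs))

theorem memLp_decay {l : ℝ} (hl : 0 ≤ l) (T t : ℝ) :
    MemLp (decay l t) 2 (volume.restrict (Icc 0 T)) :=
  MemLp.of_bound (measurable_decay l t).aestronglyMeasurable 1 (Eventually.of_forall fun s => by
    rw [Real.norm_eq_abs, abs_of_nonneg (decay_nonneg l t s)]; exact decay_le_one hl t s)

theorem IsHeatEigen.integral_convKernel_mul {f : C(UnitAddCircle, ℝ)} {l : ℝ}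
    (hf : IsHeatEigen f l) (t : ℝ) (z : ℝ × UnitAddCircle) :
    ∫ x, convKernel t x z * f x = tensor (decay l t) f z := by
  by_cases h : z.1 < t
  · have h' : z.1 ∈ Iio t := h
    simp only [convKernel, tensor, decay, indicator_of_mem h']
    exact hf _ (sub_pos.2 h) z.2
  · have h' : z.1 ∉ Iio t := h
    simp only [convKernel, tensor, decay, indicator_of_notMem h', zero_mul, integral_zero]

section Modes

variable {Ω : Type*} [MeasurableSpace Ω] {P : Measure Ω} {T : ℝ} {ξ : CylSet T → Lp ℝ 2 P}
  {O : ℝ → Ω → C(UnitAddCircle, ℝ)}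

theorem stronglyMeasurable_uncurry_field {X : Ω → C(UnitAddCircle, ℝ)}
    (hX : ∀ x, Measurable fun ω => X ω x) :
    StronglyMeasurable fun w : Ω × UnitAddCircle => X w.1 w.2 := by
  have h := stronglyMeasurable_uncurry_of_continuous_of_stronglyMeasurable
    (u := fun x ω => X ω x) (fun ω => (X ω).continuous) fun x => (hX x).stronglyMeasurable
  exact h.comp_measurable measurable_swap

theorem measurable_integral_mul {X : Ω → C(UnitAddCircle, ℝ)}
    (hX : ∀ x, Measurable fun ω => X ω x) (f : C(UnitAddCircle, ℝ)) :
    Measurable fun ω => ∫ x, X ω x * f x := by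
  refine (StronglyMeasurable.integral_prod_right
    (f := fun (ω : Ω) (x : UnitAddCircle) => X ω x * f x) ?_).measurable
  exact (stronglyMeasurable_uncurry_field hX).mul
    (f.continuous.stronglyMeasurable.comp_measurable measurable_snd)

theorem memLp_stochasticConvolution [IsProbabilityMeasure P] (hξ : IsWhiteNoise ξ)
    (hO : IsStochasticConvolution ξ O) {t : ℝ} (ht : t ∈ Icc 0 T) :
    MemLp (fun w : Ω × UnitAddCircle => O t w.1 w.2) 2 (P.prod volume) := by
  have hm := stronglyMeasurable_uncurry_field (hO.field.measurable t ht)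
  have h := memLp_two_prod (μ := (volume : Measure UnitAddCircle)) (ν := P)
    (f := fun w => O t w.2 w.1) (hm.comp_measurable measurable_swap).aestronglyMeasurable
    (lintegral_heatTrace_lt_top t) (Eventually.of_forall fun x => ?_)
  · exact h.comp_measurePreserving Measure.measurePreserving_swap
  · refine le_trans (le_of_eq ?_) (lintegral_convKernel_sq_le T t x)
    rw [← hξ.lintegral_noiseIntegral_sq (memLp_convKernel T t x)]
    refine lintegral_congr_ae ?_
    filter_upwards [hO.eq_integral t ht x] with ω hω
    rw [hω]
    rfl

/-- A stochastic Fubini theorem: the pairing of the stochastic convolution with an eigenfunction `f`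
of the heat semigroup is the noise integral of `1_{s < t} exp(-l (t - s)) f(y)`. It is proved by
integrating over an arbitrary event, which turns noise integrals into pairings with a fixed
square-integrable function on the cylinder, so that the classical Fubini theorem applies. -/
theorem IsStochasticConvolution.integral_mul_ae_eq [IsProbabilityMeasure P] (hξ : IsWhiteNoise ξ)
    (hO : IsStochasticConvolution ξ O) {f : C(UnitAddCircle, ℝ)} {l : ℝ} (hl : 0 ≤ l)
    (hf : IsHeatEigen f l) {t : ℝ} (ht : t ∈ Icc 0 T) :
    (fun ω => ∫ x, O t ω x * f x) =ᵐ[P] noiseIntegral ξ (tensor (decay l t) f) := by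
  have hf2 : MemLp f 2 (volume : Measure UnitAddCircle) :=
    MemLp.of_bound f.continuous.aestronglyMeasurable ‖f‖ (Eventually.of_forall f.norm_coe_le_norm)
  have hten := memLp_tensor (memLp_decay hl T t) f
  have hOf : Integrable (fun w : Ω × UnitAddCircle => O t w.1 w.2 * f w.2) (P.prod volume) :=
    (memLp_stochasticConvolution hξ hO ht).integrable_mul (hf2.comp_snd P)
  refine Integrable.ae_eq_of_forall_setIntegral_eq _ _ hOf.integral_prod_left
    ((Lp.memLp _).integrable (by norm_num)) fun B hB _ => ?_
  set g : Lp ℝ 2 (cylMeasure T) := ContinuousLinearMap.adjoint (wienerIntegral ξ)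
    (indicatorConstLp 2 hB (measure_ne_top P B) (1 : ℝ)) with hg
  have hset : ∀ h : ℝ × UnitAddCircle → ℝ, MemLp h 2 (cylMeasure T) →
      ∫ ω in B, noiseIntegral ξ h ω ∂P = ∫ z, g z * h z ∂cylMeasure T := by
    intro h hh
    rw [noiseIntegral_of_memLp hh, ← L2.inner_indicatorConstLp_one hB (measure_ne_top P B),
      ← ContinuousLinearMap.adjoint_inner_left, ← hg, L2.inner_def]
    refine integral_congr_ae ?_
    filter_upwards [hh.coeFn_toLp] with z hz
    rw [hz]
    simp [mul_comm]
  have hp : MemLp (fun w : UnitAddCircle × (ℝ × UnitAddCircle) => convKernel t w.1 w.2) 2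
      ((volume : Measure UnitAddCircle).prod (cylMeasure T)) :=
    memLp_two_prod (measurable_convKernel t).aestronglyMeasurable (lintegral_heatTrace_lt_top t)
      (Eventually.of_forall fun x => lintegral_convKernel_sq_le T t x)
  have hgf : MemLp (fun w : UnitAddCircle × (ℝ × UnitAddCircle) => f w.1 * g w.2) 2
      ((volume : Measure UnitAddCircle).prod (cylMeasure T)) :=
    ((Lp.memLp g).comp_snd volume).of_le_mul (c := ‖f‖)
      (hf2.aestronglyMeasurable.comp_fst.mul (Lp.memLp g).aestronglyMeasurable.comp_snd)
      (Eventually.of_forall fun w => by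
        rw [norm_mul]
        exact mul_le_mul_of_nonneg_right (f.norm_coe_le_norm _) (norm_nonneg _))
  calc ∫ ω in B, ∫ x, O t ω x * f x ∂volume ∂P
      = ∫ x, ∫ ω in B, O t ω x * f x ∂P ∂volume := by
        refine integral_integral_swap (f := fun ω x => O t ω x * f x) ?_
        rw [← Measure.restrict_univ (μ := (volume : Measure UnitAddCircle)), Measure.prod_restrict]
        exact hOf.restrict
    _ = ∫ x, ∫ z, f x * g z * convKernel t x z ∂cylMeasure T ∂volume := by
        refine integral_congr_ae (Eventually.of_forall fun x => ?_)
        simp only [integral_mul_const, mul_assoc, integral_const_mul]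
        rw [mul_comm, ← hset _ (memLp_convKernel T t x)]
        congr 1
        refine setIntegral_congr_ae hB ?_
        filter_upwards [hO.eq_integral t ht x] with ω hω _
        rw [hω]
        rfl
    _ = ∫ z, ∫ x, f x * g z * convKernel t x z ∂volume ∂cylMeasure T :=
        integral_integral_swap (f := fun x z => f x * g z * convKernel t x z)
          (hgf.integrable_mul hp)
    _ = ∫ z, g z * tensor (decay l t) f z ∂cylMeasure T := by
        refine integral_congr_ae (Eventually.of_forall fun z => ?_)
        simp only [← hf.integral_convKernel_mul t z, ← integral_const_mul]
        refine integral_congr_ae (Eventually.of_forall fun x => ?_)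
        simp only; ring
    _ = ∫ ω in B, noiseIntegral ξ (tensor (decay l t) f) ω ∂P := (hset _ hten).symm

end Modes

/-! ### Fourier modes of the mild solution -/

theorem integral_heatSemigroup_mul {f : C(UnitAddCircle, ℝ)} {l : ℝ} (hf : IsHeatEigen f l)
    {r : ℝ} (hr : 0 < r) (g : C(UnitAddCircle, ℝ)) :
    ∫ x, heatSemigroup r g x * f x = Real.exp (-(l * r)) * ∫ y, g y * f y := by
  have hc := continuous_heatKernel hr
  simp only [heatSemigroup, if_neg hr.ne', ← integral_mul_const]
  rw [integral_integral_swap (f := fun x y => heatKernel r (x - y) * g y * f x)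
    (integrable_of_continuous (by fun_prop)), ← integral_const_mul]
  refine integral_congr_ae (Eventually.of_forall fun y => ?_)
  simp only
  rw [mul_left_comm, ← hf r hr y, ← integral_const_mul]
  refine integral_congr_ae (Eventually.of_forall fun x => ?_)
  simp only; ring

/-- The integrability that Fubini needs in the mild equation. The supremum of `P_r g` is bounded by
the heat trace at `r`, which is integrable down to `r = 0`. -/
theorem integrable_heatSemigroup_mul {u : ℝ → C(UnitAddCircle, ℝ)} (hu : Continuous u)
    (f : C(UnitAddCircle, ℝ)) (t : ℝ) :
    Integrable (fun w : UnitAddCircle × ℝ => heatSemigroup (t - w.2) (u w.2) w.1 * f w.1)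
      ((volume : Measure UnitAddCircle).prod (volume.restrict (Ioo 0 t))) := by
  have hprod : (volume : Measure UnitAddCircle).prod (volume.restrict (Ioo 0 t))
      = (volume.prod volume).restrict (univ ×ˢ Ioo 0 t) := by
    rw [← Measure.prod_restrict, Measure.restrict_univ]
  have huc : Continuous fun w : ℝ × UnitAddCircle => u w.1 w.2 := by fun_prop
  have hG : StronglyMeasurable fun w : UnitAddCircle × ℝ =>
      ∫ y, convKernel t w.1 (w.2, y) * u w.2 y := by
    refine StronglyMeasurable.integral_prod_right
      (f := fun (w : UnitAddCircle × ℝ) (y : UnitAddCircle) =>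
        convKernel t w.1 (w.2, y) * u w.2 y) (Measurable.stronglyMeasurable ?_)
    have h1 : Measurable fun w : (UnitAddCircle × ℝ) × UnitAddCircle =>
        ((w.1.1, (w.1.2, w.2)) : UnitAddCircle × (ℝ × UnitAddCircle)) := by fun_prop
    have h2 : Measurable fun w : (UnitAddCircle × ℝ) × UnitAddCircle =>
        ((w.1.2, w.2) : ℝ × UnitAddCircle) := by fun_prop
    exact ((measurable_convKernel t).comp h1).mul (huc.measurable.comp h2)
  have hGe : ∀ x s, s < t → ∫ y, convKernel t x (s, y) * u s y = heatSemigroup (t - s) (u s) x := by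
    intro x s hs
    have hs' : s ∈ Iio t := hs
    simp only [heatSemigroup, if_neg (sub_pos.2 hs).ne', convKernel, indicator_of_mem hs']
  have hae : (fun w : UnitAddCircle × ℝ => (∫ y, convKernel t w.1 (w.2, y) * u w.2 y) * f w.1)
      =ᵐ[(volume : Measure UnitAddCircle).prod (volume.restrict (Ioo 0 t))]
      fun w => heatSemigroup (t - w.2) (u w.2) w.1 * f w.1 := by
    rw [hprod]
    filter_upwards [ae_restrict_mem (MeasurableSet.univ.prod measurableSet_Ioo)] with w hw
    rw [hGe _ _ hw.2.2]
  have hm := (hG.aestronglyMeasurable.mul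
    (f.continuous.aestronglyMeasurable (μ := volume)).comp_fst).congr hae
  obtain ⟨C, hC⟩ := isCompact_Icc.exists_bound_of_continuousOn (s := Icc 0 t) hu.continuousOn
  refine ⟨hm, ?_⟩
  rw [HasFiniteIntegral, lintegral_prod_symm _ hm.enorm]
  have hb : ∀ s ∈ Ioo 0 t, ∫⁻ x, ‖heatSemigroup (t - s) (u s) x * f x‖ₑ
      ≤ ENNReal.ofReal (heatTrace (t - s)) * ENNReal.ofReal (C * ‖f‖) := by
    intro s hs
    have hr : 0 < t - s := sub_pos.2 hs.2
    have hx : ∀ x, ‖heatSemigroup (t - s) (u s) x * f x‖ ≤ heatTrace (t - s) * (C * ‖f‖) := by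
      intro x
      rw [norm_mul, ← mul_assoc]
      refine mul_le_mul ?_ (f.norm_coe_le_norm x) (norm_nonneg _)
        (mul_nonneg (heatTrace_nonneg _) ((norm_nonneg _).trans (hC s ⟨hs.1.le, hs.2.le⟩)))
      rw [heatSemigroup, if_neg hr.ne']
      refine (norm_integral_le_of_norm_le_const (C := heatTrace (t - s) * C)
        (Eventually.of_forall fun y => ?_)).trans (by simp)
      rw [norm_mul]
      exact mul_le_mul (abs_heatKernel_le hr _)
        (((u s).norm_coe_le_norm y).trans (hC s ⟨hs.1.le, hs.2.le⟩)) (norm_nonneg _)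
        (heatTrace_nonneg _)
    rw [← ENNReal.ofReal_mul (heatTrace_nonneg _)]
    refine (lintegral_mono (g := fun _ => ENNReal.ofReal (heatTrace (t - s) * (C * ‖f‖)))
      fun x => ?_).trans (by simp)
    rw [← ofReal_norm]
    exact ENNReal.ofReal_le_ofReal (hx x)
  refine (setLIntegral_mono' measurableSet_Ioo hb).trans_lt ?_
  rw [lintegral_mul_const' _ _ ENNReal.ofReal_ne_top]
  refine ENNReal.mul_lt_top (lt_of_le_of_lt ?_ (lintegral_heatTrace_lt_top t))
    ENNReal.ofReal_lt_top
  rw [← lintegral_indicator measurableSet_Ioo, ← lintegral_indicator measurableSet_Ioc,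
    ← lintegral_sub_left_eq_self ((Ioc 0 t).indicator fun r => ENNReal.ofReal (heatTrace r)) t]
  refine lintegral_mono fun s => ?_
  by_cases hs : s ∈ Ioo 0 t
  swap; · simp [indicator_of_notMem hs]
  rw [indicator_of_mem hs,
    indicator_of_mem (show t - s ∈ Ioc 0 t from ⟨by linarith [hs.2], by linarith [hs.1]⟩)]

/-- Pairing the mild equation with an eigenfunction decouples it into a scalar Volterra equation. -/
theorem integral_mild_mul {u : ℝ → C(UnitAddCircle, ℝ)} (hu : Continuous u)
    {f : C(UnitAddCircle, ℝ)} {l : ℝ} (hf : IsHeatEigen f l) {t : ℝ} (ht : 0 ≤ t)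
    {o v : C(UnitAddCircle, ℝ)}
    (h : ∀ x, v x = (∫ s in (0)..t, heatSemigroup (t - s) (u s) x) + o x) :
    ∫ x, v x * f x
      = (∫ s in (0)..t, Real.exp (-(l * (t - s))) * ∫ x, u s x * f x) + ∫ x, o x * f x := by
  have hi := integrable_heatSemigroup_mul hu f t
  have h1 : ∀ x, v x * f x
      = (∫ s in Ioo 0 t, heatSemigroup (t - s) (u s) x * f x) + o x * f x := by
    intro x
    rw [h x, add_mul, intervalIntegral.integral_of_le ht, integral_Ioc_eq_integral_Ioo,
      integral_mul_const]
  simp only [h1]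
  rw [integral_add hi.integral_prod_left (integrable_of_continuous (by fun_prop)),
    integral_integral_swap (f := fun x s => heatSemigroup (t - s) (u s) x * f x) hi,
    intervalIntegral.integral_of_le ht, integral_Ioc_eq_integral_Ioo]
  congr 1
  exact setIntegral_congr_fun measurableSet_Ioo fun s hs =>
    integral_heatSemigroup_mul hf (sub_pos.2 hs.2) (u s)

/-- Variation of constants for the scalar Volterra equation
`X_t = ∫₀ᵗ exp(-l (t - s)) X_s ds + o_t`: the function `exp(-t) ∫₀ᵗ exp(l s) X_s ds` has derivative
`exp(-t) exp(l t) o_t`. -/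
theorem volterra_solution {X o : ℝ → ℝ} (hX : Continuous X) {l : ℝ}
    (h : ∀ t ∈ Icc (0 : ℝ) 1, X t = (∫ s in (0)..t, Real.exp (-(l * (t - s))) * X s) + o t) :
    X 1 = o 1 + ∫ s in (0)..1, Real.exp ((1 - l) * (1 - s)) * o s := by
  set F : ℝ → ℝ := fun t => ∫ s in (0)..t, Real.exp (l * s) * X s with hF
  have hcont : Continuous fun s => Real.exp (l * s) * X s := by fun_prop
  have hFd : ∀ t, HasDerivAt F (Real.exp (l * t) * X t) t := fun t =>
    intervalIntegral.integral_hasDerivAt_right (hcont.intervalIntegrable _ _)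
      (hcont.stronglyMeasurableAtFilter _ _) hcont.continuousAt
  have hFc : Continuous F := continuous_iff_continuousAt.2 fun t => (hFd t).continuousAt
  have hFX : ∀ t ∈ Icc (0 : ℝ) 1, X t = Real.exp (-(l * t)) * F t + o t := by
    intro t ht
    rw [h t ht, hF, ← intervalIntegral.integral_const_mul]
    congr 1
    refine intervalIntegral.integral_congr fun s _ => ?_
    rw [← mul_assoc, ← Real.exp_add]
    congr 2; ring
  have hH : ∀ t, HasDerivAt (fun t => Real.exp (-t) * F t)
      (Real.exp (-t) * (Real.exp (l * t) * X t - F t)) t := by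
    intro t
    have h1 := ((hasDerivAt_id t).neg.exp).mul (hFd t)
    refine h1.congr_deriv ?_
    simp only [id, Pi.neg_apply]
    ring
  have hint := intervalIntegral.integral_eq_sub_of_hasDerivAt (a := 0) (b := 1)
    (fun t _ => hH t) (Continuous.intervalIntegrable (by fun_prop) _ _)
  have hF0 : F 0 = 0 := by simp [hF]
  rw [hF0, mul_zero, sub_zero] at hint
  rw [hFX 1 (by simp), add_comm]
  congr 1
  have h2 : ∀ s ∈ uIcc (0 : ℝ) 1, Real.exp ((1 - l) * (1 - s)) * o s
      = Real.exp (1 - l) * (Real.exp (-s) * (Real.exp (l * s) * X s - F s)) := by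
    intro s hs
    rw [uIcc_of_le zero_le_one] at hs
    have h3 : Real.exp (l * s) * X s - F s = Real.exp (l * s) * o s := by
      rw [hFX s hs, mul_add, ← mul_assoc, ← Real.exp_add]
      simp
    rw [h3, ← mul_assoc, ← mul_assoc, ← Real.exp_add, ← Real.exp_add]
    congr 2; ring
  rw [intervalIntegral.integral_congr h2, intervalIntegral.integral_const_mul, hint, ← mul_assoc,
    ← Real.exp_add]
  congr 2; ring

theorem continuous_integral_mul {v : ℝ → C(UnitAddCircle, ℝ)} (hv : Continuous v)
    (f : C(UnitAddCircle, ℝ)) : Continuous fun t => ∫ x, v t x * f x := by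
  have hc : Continuous fun w : ℝ × UnitAddCircle => v w.1 w.2 * f w.2 := by fun_prop
  simpa using continuous_parametric_integral_of_continuous
    (f := fun t x => v t x * f x) (μ := volume) hc isCompact_univ

/-- The pairing of the mild solution with an eigenfunction, expressed through the stochastic
convolution. -/
theorem integral_mildSolution_mul {u O : ℝ → C(UnitAddCircle, ℝ)} (hu : ContinuousOn u (Icc 0 1))
    {f : C(UnitAddCircle, ℝ)} {l : ℝ} (hf : IsHeatEigen f l)
    (h : ∀ t ∈ Icc (0 : ℝ) 1, ∀ x,
      u t x = (∫ s in (0)..t, heatSemigroup (t - s) (u s) x) + O t x) :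
    ∫ x, u 1 x * f x = (∫ x, O 1 x * f x)
      + ∫ s in (0)..1, Real.exp ((1 - l) * (1 - s)) * ∫ x, O s x * f x := by
  -- Freezing `u` outside `[0, 1]` makes it continuous on the whole line.
  set v : ℝ → C(UnitAddCircle, ℝ) := fun t => u (projIcc 0 1 zero_le_one t) with hv
  have hvc : Continuous v :=
    hu.comp_continuous (continuous_subtype_val.comp continuous_projIcc) fun t => (projIcc _ _ _ t).2
  have hvu : ∀ t ∈ Icc (0 : ℝ) 1, v t = u t := fun t ht => by
    simp only [hv, projIcc_of_mem zero_le_one ht]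
  have h' : ∀ t ∈ Icc (0 : ℝ) 1, ∀ x,
      v t x = (∫ s in (0)..t, heatSemigroup (t - s) (v s) x) + O t x := by
    intro t ht x
    rw [hvu t ht, h t ht x]
    congr 1
    refine intervalIntegral.integral_congr fun s hs => ?_
    rw [uIcc_of_le ht.1] at hs
    simp only [hvu s ⟨hs.1, hs.2.trans ht.2⟩]
  rw [← hvu 1 (by simp)]
  exact volterra_solution (continuous_integral_mul hvc f) fun t ht => integral_mild_mul hvc hf ht.1 (h' t ht)

/-! ### Second moments of the modes of the mild solution -/

section Moments

variable {Ω : Type*} [MeasurableSpace Ω] {P : Measure Ω} {ξ : CylSet 1 → Lp ℝ 2 P}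
  {O u : ℝ → Ω → C(UnitAddCircle, ℝ)}

/-- The pairings of a continuous field with `f` have a jointly measurable version. It is obtained by
discarding a measurable null set outside of which the paths are continuous. -/
theorem IsContinuousField.exists_measurable_pairing (hO : IsContinuousField P 1 O)
    (f : C(UnitAddCircle, ℝ)) :
    ∃ o : Ω → ℝ → ℝ, StronglyMeasurable (Function.uncurry o) ∧
      ∀ᵐ ω ∂P, ∀ s ∈ Icc (0 : ℝ) 1, o ω s = ∫ x, O s ω x * f x := by
  obtain ⟨S, hS, hSm, hSc⟩ := hO.continuousOn.exists_measurable_mem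
  have hproj : ∀ s, (projIcc (0 : ℝ) 1 zero_le_one s : ℝ) ∈ Icc (0 : ℝ) 1 :=
    fun s => (projIcc _ _ _ s).2
  refine ⟨fun ω s => S.indicator
    (fun ω => ∫ x, O (projIcc 0 1 zero_le_one s) ω x * f x) ω, ?_, ?_⟩
  · have h := stronglyMeasurable_uncurry_of_continuous_of_stronglyMeasurable
      (u := fun (s : ℝ) (ω : Ω) => S.indicator
        (fun ω => ∫ x, O (projIcc 0 1 zero_le_one s) ω x * f x) ω) ?_ ?_
    · exact h.comp_measurable measurable_swap
    · intro ω
      by_cases hω : ω ∈ S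
      · simp only [indicator_of_mem hω]
        exact continuous_integral_mul (v := fun s => O (projIcc 0 1 zero_le_one s) ω)
          ((hSc ω hω).comp_continuous
            (continuous_subtype_val.comp (continuous_projIcc (h := zero_le_one))) hproj) f
      · simp only [indicator_of_notMem hω]
        exact continuous_const
    · exact fun s => (measurable_integral_mul (hO.measurable _ (hproj s)) f).stronglyMeasurable
        |>.indicator hSm
  · filter_upwards [hS] with ω hω s hs
    rw [indicator_of_mem hω, projIcc_of_mem zero_le_one hs]

instance : IsProbabilityMeasure (volume.restrict (Ioc (0 : ℝ) 1)) :=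
  ⟨by rw [Measure.restrict_apply_univ, Real.volume_Ioc]; simp⟩

theorem memLp_two_uncurry [IsProbabilityMeasure P] {o : Ω → ℝ → ℝ}
    (ho : StronglyMeasurable (Function.uncurry o)) {β : ℝ≥0∞} (hβ : β < ∞)
    (h : ∀ s ∈ Ioc (0 : ℝ) 1, eLpNorm (fun ω => o ω s) 2 P ≤ β) :
    MemLp (Function.uncurry o) 2 (P.prod (volume.restrict (Ioc (0 : ℝ) 1))) := by
  have h1 := memLp_two_prod (μ := volume.restrict (Ioc (0 : ℝ) 1)) (ν := P)
    (f := fun w => o w.2 w.1) (ho.comp_measurable measurable_swap).aestronglyMeasurable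
    (ENNReal.pow_lt_top (n := 2) hβ) ?_
  · exact h1.comp_measurePreserving Measure.measurePreserving_swap
  · filter_upwards [ae_restrict_mem measurableSet_Ioc] with s hs
    rw [← eLpNorm_two_sq]
    exact pow_le_pow_left' (h s hs) 2

/-- Minkowski's inequality for a weighted time integral over the unit interval. -/
theorem eLpNorm_integral_mul_le [IsProbabilityMeasure P] {o : Ω → ℝ → ℝ}
    (ho : StronglyMeasurable (Function.uncurry o)) {β : ℝ≥0∞}
    (h : ∀ s ∈ Ioc (0 : ℝ) 1, eLpNorm (fun ω => o ω s) 2 P ≤ β) {w : ℝ → ℝ} (hw : Measurable w)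
    {c : ℝ≥0∞} (hwc : ∀ s ∈ Ioc (0 : ℝ) 1, ‖w s‖ₑ ≤ c) :
    eLpNorm (fun ω => ∫ s in (0)..1, w s * o ω s) 2 P ≤ c * β := by
  have hos : ∀ ω, StronglyMeasurable (o ω) := fun ω => ho.comp_measurable measurable_prodMk_left
  rw [← ENNReal.pow_le_pow_left_iff two_ne_zero, eLpNorm_two_sq]
  have h1 : ∀ ω, ‖∫ s in (0)..1, w s * o ω s‖ₑ ^ 2
      ≤ ∫⁻ s in Ioc (0 : ℝ) 1, ‖w s * o ω s‖ₑ ^ 2 := by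
    intro ω
    rw [intervalIntegral.integral_of_le zero_le_one, ← eLpNorm_two_sq]
    refine pow_le_pow_left' ((enorm_integral_le_lintegral_enorm _).trans ?_) 2
    rw [← eLpNorm_one_eq_lintegral_enorm]
    exact eLpNorm_le_eLpNorm_of_exponent_le (by norm_num)
      (hw.stronglyMeasurable.mul (hos ω)).aestronglyMeasurable
  calc ∫⁻ ω, ‖∫ s in (0)..1, w s * o ω s‖ₑ ^ 2 ∂P
      ≤ ∫⁻ ω, ∫⁻ s in Ioc (0 : ℝ) 1, ‖w s * o ω s‖ₑ ^ 2 ∂volume ∂P := lintegral_mono h1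
    _ = ∫⁻ s in Ioc (0 : ℝ) 1, ∫⁻ ω, ‖w s * o ω s‖ₑ ^ 2 ∂P ∂volume := by
        refine lintegral_lintegral_swap (f := fun ω s => ‖w s * o ω s‖ₑ ^ 2) ?_
        exact (((hw.comp measurable_snd).mul ho.measurable).enorm.pow_const 2).aemeasurable
    _ ≤ ∫⁻ s in Ioc (0 : ℝ) 1, (c * β) ^ 2 := by
        refine setLIntegral_mono' measurableSet_Ioc fun s hs => ?_
        simp only [enorm_mul, mul_pow]
        have hosm : Measurable fun ω => o ω s := ho.measurable.comp measurable_prodMk_right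
        rw [lintegral_const_mul _ (hosm.enorm.pow_const 2), ← eLpNorm_two_sq]
        exact mul_le_mul' (pow_le_pow_left' (hwc s hs) 2) (pow_le_pow_left' (h s hs) 2)
    _ = (c * β) ^ 2 := by simp

theorem integral_integral_mul_swap [IsProbabilityMeasure P] {o : Ω → ℝ → ℝ}
    (ho : StronglyMeasurable (Function.uncurry o)) {β : ℝ≥0∞} (hβ : β < ∞)
    (h : ∀ s ∈ Ioc (0 : ℝ) 1, eLpNorm (fun ω => o ω s) 2 P ≤ β) {w : ℝ → ℝ} (hw : Measurable w)
    {c : ℝ} (hwc : ∀ s ∈ Ioc (0 : ℝ) 1, ‖w s‖ ≤ c) {Y : Ω → ℝ} (hY : MemLp Y 2 P) :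
    ∫ ω, (∫ s in (0)..1, w s * o ω s) * Y ω ∂P
      = ∫ s in (0)..1, w s * ∫ ω, o ω s * Y ω ∂P := by
  simp only [intervalIntegral.integral_of_le (zero_le_one' ℝ), ← integral_mul_const,
    ← integral_const_mul]
  rw [integral_integral_swap (f := fun ω s => w s * o ω s * Y ω)]
  · refine integral_congr_ae (Eventually.of_forall fun s => ?_)
    refine integral_congr_ae (Eventually.of_forall fun ω => ?_)
    simp only; ring
  · have h1 : Integrable (fun z : Ω × ℝ => o z.1 z.2 * Y z.1)
        (P.prod (volume.restrict (Ioc (0 : ℝ) 1))) :=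
      (memLp_two_uncurry ho hβ h).integrable_mul (hY.comp_fst _)
    refine (h1.bdd_mul (c := c) (f := fun z => w z.2) (hw.comp measurable_snd).aestronglyMeasurable
      ?_).congr (Eventually.of_forall fun z => ?_)
    · have : ∀ᵐ s ∂volume.restrict (Ioc (0 : ℝ) 1), ‖w s‖ ≤ c := by
        filter_upwards [ae_restrict_mem measurableSet_Ioc] with s hs using hwc s hs
      exact Measure.quasiMeasurePreserving_snd.ae this
    · simp only [Function.uncurry]; ring

theorem lintegral_decay_sq_le_one {l : ℝ} (hl : 0 ≤ l) (s : ℝ) :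
    ∫⁻ r in Icc (0 : ℝ) 1, ‖decay l s r‖ₑ ^ 2 ≤ 1 := by
  refine (setLIntegral_mono' (g := fun _ => 1) measurableSet_Icc fun r _ => ?_).trans (by simp)
  refine pow_le_one₀ zero_le ?_
  rw [Real.enorm_of_nonneg (decay_nonneg l s r), ENNReal.ofReal_le_one]
  exact decay_le_one hl s r

/-- The smoothing of the heat flow: the variance of a mode of the stochastic convolution is at most
the inverse of its decay rate. -/
theorem lintegral_decay_sq_le_inv {l : ℝ} (hl : 0 < l) (s : ℝ) :
    ∫⁻ r in Icc (0 : ℝ) 1, ‖decay l s r‖ₑ ^ 2 ≤ ENNReal.ofReal l⁻¹ := by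
  have h1 : ∀ r ∈ Icc (0 : ℝ) 1, ‖decay l s r‖ₑ ^ 2
      ≤ (Ioc 0 s).indicator (fun r => ENNReal.ofReal (Real.exp (-(l * r)))) (s - r) := by
    intro r hr
    rw [Real.enorm_of_nonneg (decay_nonneg l s r)]
    refine (pow_le_of_le_one zero_le (ENNReal.ofReal_le_one.2 (decay_le_one hl.le s r))
      two_ne_zero).trans ?_
    by_cases hrs : r < s
    · rw [indicator_of_mem (show s - r ∈ Ioc 0 s from ⟨sub_pos.2 hrs, by linarith [hr.1]⟩),
        decay, indicator_of_mem (show r ∈ Iio s from hrs)]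
    · rw [decay, indicator_of_notMem (show r ∉ Iio s from hrs)]
      simp
  calc ∫⁻ r in Icc (0 : ℝ) 1, ‖decay l s r‖ₑ ^ 2
      ≤ ∫⁻ r in Icc (0 : ℝ) 1,
        (Ioc 0 s).indicator (fun r => ENNReal.ofReal (Real.exp (-(l * r)))) (s - r) :=
        setLIntegral_mono' measurableSet_Icc h1
    _ ≤ ∫⁻ r, (Ioc 0 s).indicator (fun r => ENNReal.ofReal (Real.exp (-(l * r)))) (s - r) :=
        setLIntegral_le_lintegral _ _
    _ = ∫⁻ r in Ioc 0 s, ENNReal.ofReal (Real.exp (-(l * r))) := by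
        rw [lintegral_sub_left_eq_self
          ((Ioc 0 s).indicator fun r => ENNReal.ofReal (Real.exp (-(l * r)))) s,
          lintegral_indicator measurableSet_Ioc]
    _ ≤ ENNReal.ofReal l⁻¹ := lintegral_exp_le hl s

theorem lintegral_tensor_sq_le {φ : ℝ → ℝ} (hφ : Measurable φ) {f : C(UnitAddCircle, ℝ)}
    (hf : ‖f‖ ≤ 1) : ∫⁻ z, ‖tensor φ f z‖ₑ ^ 2 ∂cylMeasure 1 ≤ ∫⁻ r in Icc 0 1, ‖φ r‖ₑ ^ 2 := by
  have hfe : ∀ y, ‖f y‖ₑ ≤ 1 := fun y => by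
    rw [← ofReal_norm, ENNReal.ofReal_le_one]
    exact (f.norm_coe_le_norm y).trans hf
  rw [cylMeasure_eq_prod]
  refine (lintegral_mono (g := fun z => ‖φ z.1‖ₑ ^ 2 * 1) fun z => ?_).trans ?_
  · rw [tensor, enorm_mul, mul_pow]
    exact mul_le_mul_right (pow_le_one₀ zero_le (hfe z.2)) _
  · rw [lintegral_prod_mul (f := fun s => ‖φ s‖ₑ ^ 2) (g := fun _ => 1)
      (hφ.enorm.pow_const 2).aemeasurable aemeasurable_const]
    simp

theorem IsMildSolution.ae_integral_mul_eq
    (hu : IsMildSolution P 1 (fun r => r) (fun _ => 0) O u)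
    {f : C(UnitAddCircle, ℝ)} {l : ℝ} (hf : IsHeatEigen f l) :
    ∀ᵐ ω ∂P, ∫ x, u 1 ω x * f x = (∫ x, O 1 ω x * f x)
      + ∫ s in (0)..1, Real.exp ((1 - l) * (1 - s)) * ∫ x, O s ω x * f x := by
  filter_upwards [hu.mild, hu.field.continuousOn] with ω hω hc
  refine integral_mildSolution_mul (u := fun t => u t ω) (O := fun t => O t ω) hc hf
    fun t ht x => ?_
  rw [hω t ht x]
  simp [heatSemigroup]

/-- The weight from the variation of constants is at most `e`, whatever the frequency. -/
theorem exp_weight_le {l : ℝ} (hl : 0 ≤ l) {s : ℝ} (hs : s ∈ Ioc (0 : ℝ) 1) :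
    ‖Real.exp ((1 - l) * (1 - s))‖ ≤ 3 := by
  rw [Real.norm_eq_abs, abs_of_pos (Real.exp_pos _)]
  refine (Real.exp_le_exp.2 (show (1 - l) * (1 - s) ≤ 1 by nlinarith [hs.1, hs.2])).trans ?_
  linarith [Real.exp_one_lt_d9]

theorem IsStochasticConvolution.eLpNorm_pairing_le [IsProbabilityMeasure P] (hξ : IsWhiteNoise ξ)
    (hO : IsStochasticConvolution ξ O) {f : C(UnitAddCircle, ℝ)} (hf1 : ‖f‖ ≤ 1) {l : ℝ}
    (hl : 0 ≤ l) (hf : IsHeatEigen f l) {b : ℝ≥0∞}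
    (hb : ∀ s, ∫⁻ r in Icc (0 : ℝ) 1, ‖decay l s r‖ₑ ^ 2 ≤ b ^ 2) {s : ℝ}
    (hs : s ∈ Icc (0 : ℝ) 1) : eLpNorm (fun ω => ∫ x, O s ω x * f x) 2 P ≤ b := by
  rw [eLpNorm_congr_ae (hO.integral_mul_ae_eq hξ hl hf hs),
    ← ENNReal.pow_le_pow_left_iff two_ne_zero, eLpNorm_two_sq,
    hξ.lintegral_noiseIntegral_sq (memLp_tensor (memLp_decay hl 1 s) f)]
  exact (lintegral_tensor_sq_le (measurable_decay l s) hf1).trans (hb s)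

theorem IsMildSolution.eLpNorm_pairing_le [IsProbabilityMeasure P] (hξ : IsWhiteNoise ξ)
    (hO : IsStochasticConvolution ξ O) (hu : IsMildSolution P 1 (fun r => r) (fun _ => 0) O u)
    {f : C(UnitAddCircle, ℝ)} (hf1 : ‖f‖ ≤ 1) {l : ℝ} (hl : 0 ≤ l) (hf : IsHeatEigen f l)
    {b : ℝ≥0∞} (hb : ∀ s, ∫⁻ r in Icc (0 : ℝ) 1, ‖decay l s r‖ₑ ^ 2 ≤ b ^ 2) :
    eLpNorm (fun ω => ∫ x, u 1 ω x * f x) 2 P ≤ 4 * b := by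
  obtain ⟨o, ho, hoO⟩ := hO.field.exists_measurable_pairing f
  have hob : ∀ s ∈ Icc (0 : ℝ) 1, eLpNorm (fun ω => o ω s) 2 P ≤ b := fun s hs => by
    rw [eLpNorm_congr_ae (hoO.mono fun ω h => h s hs)]
    exact hO.eLpNorm_pairing_le hξ hf1 hl hf hb hs
  have hX : (fun ω => ∫ x, u 1 ω x * f x) =ᵐ[P] (fun ω => o ω 1)
      + fun ω => ∫ s in (0)..1, Real.exp ((1 - l) * (1 - s)) * o ω s := by
    filter_upwards [hu.ae_integral_mul_eq hf, hoO] with ω h1 h2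
    rw [h1, Pi.add_apply, h2 1 (by simp)]
    congr 1
    refine intervalIntegral.integral_congr fun s hs => ?_
    rw [uIcc_of_le zero_le_one] at hs
    simp only [h2 s hs]
  have hw : Measurable fun s => Real.exp ((1 - l) * (1 - s)) := by fun_prop
  have hint : StronglyMeasurable fun ω => ∫ s in (0)..1, Real.exp ((1 - l) * (1 - s)) * o ω s := by
    simp only [intervalIntegral.integral_of_le (zero_le_one' ℝ)]
    refine StronglyMeasurable.integral_prod_right
      (f := fun ω s => Real.exp ((1 - l) * (1 - s)) * o ω s) ?_
    exact (hw.stronglyMeasurable.comp_measurable measurable_snd).mul ho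
  rw [eLpNorm_congr_ae hX]
  refine (eLpNorm_add_le (ho.comp_measurable measurable_prodMk_right).aestronglyMeasurable
    hint.aestronglyMeasurable (by norm_num)).trans ?_
  have h3 := eLpNorm_integral_mul_le (c := 3) ho (fun s hs => hob s ⟨hs.1.le, hs.2⟩) hw
    fun s hs => by
      rw [← ofReal_norm]
      exact (ENNReal.ofReal_le_ofReal (exp_weight_le hl hs)).trans (by simp)
  calc _ ≤ b + 3 * b := add_le_add (hob 1 (by simp)) h3
    _ = 4 * b := by ring

/-- The covariance of a mode of the mild solution at time `1` with a noise integral. -/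
theorem IsMildSolution.integral_pairing_mul_noiseIntegral [IsProbabilityMeasure P]
    (hξ : IsWhiteNoise ξ)
    (hO : IsStochasticConvolution ξ O) (hu : IsMildSolution P 1 (fun r => r) (fun _ => 0) O u)
    {f : C(UnitAddCircle, ℝ)} (hf1 : ‖f‖ ≤ 1) {l : ℝ} (hl : 0 ≤ l) (hf : IsHeatEigen f l)
    {φ : ℝ → ℝ} (hφ : MemLp φ 2 (volume.restrict (Icc 0 1))) (g : C(UnitAddCircle, ℝ)) :
    ∫ ω, (∫ x, u 1 ω x * f x) * noiseIntegral ξ (tensor φ g) ω ∂P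
      = (∫ y, f y * g y) * ((∫ r in Icc (0 : ℝ) 1, decay l 1 r * φ r)
        + ∫ s in (0)..1, Real.exp ((1 - l) * (1 - s)) * ∫ r in Icc (0 : ℝ) 1, decay l s r * φ r)
      := by
  obtain ⟨o, ho, hoO⟩ := hO.field.exists_measurable_pairing f
  have hob : ∀ s ∈ Icc (0 : ℝ) 1, eLpNorm (fun ω => o ω s) 2 P ≤ 1 := fun s hs => by
    rw [eLpNorm_congr_ae (hoO.mono fun ω h => h s hs)]
    exact hO.eLpNorm_pairing_le hξ hf1 hl hf
      (fun s => by rw [one_pow]; exact lintegral_decay_sq_le_one hl s) hs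
  have hY : MemLp (noiseIntegral ξ (tensor φ g)) 2 P := Lp.memLp _
  have hw : Measurable fun s => Real.exp ((1 - l) * (1 - s)) := by fun_prop
  have hcov : ∀ s ∈ Icc (0 : ℝ) 1, ∫ ω, o ω s * noiseIntegral ξ (tensor φ g) ω ∂P
      = (∫ y, f y * g y) * ∫ r in Icc (0 : ℝ) 1, decay l s r * φ r := by
    intro s hs
    rw [mul_comm, ← integral_tensor_mul_tensor, ← hξ.integral_noiseIntegral_mul
      (memLp_tensor (memLp_decay hl 1 s) f) (memLp_tensor hφ g)]
    refine integral_congr_ae ?_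
    filter_upwards [hoO, hO.integral_mul_ae_eq hξ hl hf hs] with ω h1 h2
    rw [h1 s hs, h2]
  have hX : (fun ω => (∫ x, u 1 ω x * f x) * noiseIntegral ξ (tensor φ g) ω) =ᵐ[P]
      fun ω => o ω 1 * noiseIntegral ξ (tensor φ g) ω
        + (∫ s in (0)..1, Real.exp ((1 - l) * (1 - s)) * o ω s)
          * noiseIntegral ξ (tensor φ g) ω := by
    filter_upwards [hu.ae_integral_mul_eq hf, hoO] with ω h1 h2
    rw [h1, h2 1 (by simp), ← add_mul]
    congr 2
    refine intervalIntegral.integral_congr fun s hs => ?_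
    rw [uIcc_of_le zero_le_one] at hs
    simp only [h2 s hs]
  have hm1 : MemLp (fun ω => o ω 1) 2 P :=
    ⟨(ho.comp_measurable measurable_prodMk_right).aestronglyMeasurable,
      (hob 1 (by simp)).trans_lt ENNReal.one_lt_top⟩
  have hm2 : MemLp (fun ω => ∫ s in (0)..1, Real.exp ((1 - l) * (1 - s)) * o ω s) 2 P := by
    refine ⟨?_, (eLpNorm_integral_mul_le (c := ENNReal.ofReal 3) ho
      (fun s hs => hob s ⟨hs.1.le, hs.2⟩) hw fun s hs => ?_).trans_lt ?_⟩
    · simp only [intervalIntegral.integral_of_le (zero_le_one' ℝ)]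
      refine (StronglyMeasurable.integral_prod_right
        (f := fun ω s => Real.exp ((1 - l) * (1 - s)) * o ω s) ?_).aestronglyMeasurable
      exact (hw.stronglyMeasurable.comp_measurable measurable_snd).mul ho
    · rw [← ofReal_norm]
      exact ENNReal.ofReal_le_ofReal (exp_weight_le hl hs)
    · exact ENNReal.mul_lt_top ENNReal.ofReal_lt_top ENNReal.one_lt_top
  have hi1 : Integrable (fun ω => o ω 1 * noiseIntegral ξ (tensor φ g) ω) P :=
    hm1.integrable_mul hY
  have hi2 : Integrable (fun ω => (∫ s in (0)..1, Real.exp ((1 - l) * (1 - s)) * o ω s)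
      * noiseIntegral ξ (tensor φ g) ω) P := hm2.integrable_mul hY
  rw [integral_congr_ae hX, integral_add hi1 hi2,
    integral_integral_mul_swap ho ENNReal.one_lt_top (fun s hs => hob s ⟨hs.1.le, hs.2⟩) hw
      (fun s hs => exp_weight_le hl hs) hY, hcov 1 (by simp), mul_add,
    ← intervalIntegral.integral_const_mul]
  congr 1
  refine intervalIntegral.integral_congr fun s hs => ?_
  rw [uIcc_of_le zero_le_one] at hs
  simp only [hcov s hs]
  ring

end Moments

/-! ### Conditional expectation as best approximation -/

theorem norm_sub_condExpL2_le {Ω H : Type*} {G : MeasurableSpace Ω} [mΩ : MeasurableSpace Ω]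
    {P : Measure Ω} [NormedAddCommGroup H] [InnerProductSpace ℝ H] [CompleteSpace H]
    (hG : G ≤ mΩ) (f : Lp H 2 P) : ‖f - (condExpL2 H ℝ hG f : Lp H 2 P)‖ ≤ ‖f‖ := by
  have : Fact (G ≤ mΩ) := ⟨hG⟩
  have h := Submodule.starProjection_minimal (U := lpMeas H ℝ G 2 P) f
  have h2 : ‖f - (condExpL2 H ℝ hG f : Lp H 2 P)‖
      = ⨅ x : lpMeas H ℝ G 2 P, ‖f - x‖ := h
  rw [h2]
  refine (ciInf_le ⟨0, ?_⟩ (0 : lpMeas H ℝ G 2 P)).trans (by simp)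
  rintro _ ⟨x, rfl⟩
  exact norm_nonneg _

theorem eLpNorm_sub_condExp_le {Ω H : Type*} {G : MeasurableSpace Ω} [mΩ : MeasurableSpace Ω]
    {P : Measure Ω} [IsFiniteMeasure P] [NormedAddCommGroup H] [InnerProductSpace ℝ H]
    [CompleteSpace H] (hG : G ≤ mΩ) {f : Ω → H} (hf : MemLp f 2 P) :
    eLpNorm (f - P[f | G]) 2 P ≤ eLpNorm f 2 P := by
  have h := norm_sub_condExpL2_le hG (hf.toLp f)
  have h1 := hf.condExpL2_ae_eq_condExp (𝕜 := ℝ) hG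
  rw [Lp.norm_def, Lp.norm_def, ENNReal.toReal_le_toReal (Lp.eLpNorm_ne_top _)
    (Lp.eLpNorm_ne_top _), eLpNorm_congr_ae hf.coeFn_toLp] at h
  refine le_trans (le_of_eq (eLpNorm_congr_ae ?_)) h
  filter_upwards [h1, hf.coeFn_toLp, Lp.coeFn_sub (hf.toLp f)
    (condExpL2 H ℝ hG (hf.toLp f) : Lp H 2 P)] with ω h2 h3 h4
  rw [h4, Pi.sub_apply, Pi.sub_apply, h2, h3]

/-- The conditional expectation is the best approximation. A competitor `Z` at finite distance from
`U` is square-integrable, and `Z` does not change the deviation of `U - Z` from its conditional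
expectation. -/
theorem bestError_eq_condExpError {Ω : Type*} {G : MeasurableSpace Ω} [mΩ : MeasurableSpace Ω]
    {P : Measure Ω} [IsFiniteMeasure P] (hG : G ≤ mΩ)
    {U : Ω → Lp ℝ 2 (volume : Measure UnitAddCircle)} (hU : MemLp U 2 P) :
    bestError G P U = condExpError G P U := by
  refine le_antisymm (iInf_le_of_le ⟨P[U | G], stronglyMeasurable_condExp⟩ le_rfl)
    (le_iInf fun Z => ?_)
  obtain ⟨Z, hZ⟩ := Z
  have hZm : AEStronglyMeasurable Z P := (hZ.mono hG).aestronglyMeasurable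
  by_cases hfin : l2Error P U Z = ∞
  · simp only [hfin, le_top]
  have hf : MemLp (U - Z) 2 P := ⟨hU.aestronglyMeasurable.sub hZm, lt_top_iff_ne_top.2 hfin⟩
  have hZ2 : MemLp Z 2 P := by simpa using hU.sub hf
  refine le_trans (le_of_eq (eLpNorm_congr_ae ?_)) (eLpNorm_sub_condExp_le (f := U - Z) hG hf)
  have h1 := condExp_sub (hU.integrable one_le_two) (hZ2.integrable one_le_two) G
  rw [condExp_of_stronglyMeasurable hG hZ (hZ2.integrable one_le_two)] at h1
  filter_upwards [h1] with ω hω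
  rw [Pi.sub_apply, hω, Pi.sub_apply, Pi.sub_apply]
  exact (sub_sub_sub_cancel_right _ _ _).symm

theorem sq_integral_mul_le {Ω : Type*} [MeasurableSpace Ω] {P : Measure Ω} {X Y : Ω → ℝ}
    (hX : MemLp X 2 P) (hY : MemLp Y 2 P) :
    (∫ ω, X ω * Y ω ∂P) ^ 2 ≤ (∫ ω, X ω ^ 2 ∂P) * ∫ ω, Y ω ^ 2 ∂P := by
  have hin : ∀ {A B : Ω → ℝ} (hA : MemLp A 2 P) (hB : MemLp B 2 P),
      inner ℝ (hA.toLp A) (hB.toLp B) = ∫ ω, A ω * B ω ∂P := by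
    intro A B hA hB
    rw [L2.inner_def]
    refine integral_congr_ae ?_
    filter_upwards [hA.coeFn_toLp, hB.coeFn_toLp] with ω h1 h2
    rw [h1, h2]
    simp [mul_comm]
  have h := real_inner_mul_inner_self_le (hX.toLp X) (hY.toLp Y)
  simpa only [hin, ← pow_two] using h

/-- A lower bound for the error of the conditional expectation of a Hilbert-valued `U`: along each
direction `e i` of an orthonormal family, test against a variable `Y i` that is uncorrelated with
everything that is `G`-measurable. Bessel's inequality adds up the contributions. -/
theorem sum_le_integral_norm_sub_condExp_sq {Ω H ι : Type*} {G : MeasurableSpace Ω}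
    [mΩ : MeasurableSpace Ω] {P : Measure Ω} [IsFiniteMeasure P] [NormedAddCommGroup H]
    [InnerProductSpace ℝ H] [CompleteSpace H] (hG : G ≤ mΩ) {U : Ω → H} (hU : MemLp U 2 P)
    {e : ι → H} (he : Orthonormal ℝ e) (s : Finset ι) {Y : ι → Ω → ℝ}
    (hY : ∀ i ∈ s, MemLp (Y i) 2 P) (hYG : ∀ i ∈ s, P[Y i | G] =ᵐ[P] 0) {b : ι → ℝ}
    {v : ι → ℝ} (hpos : ∀ i ∈ s, 0 < v i) (hYv : ∀ i ∈ s, ∫ ω, Y i ω ^ 2 ∂P ≤ v i)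
    (hb : ∀ i ∈ s, b i * v i ≤ (∫ ω, inner ℝ (e i) (U ω) * Y i ω ∂P) ^ 2) :
    ∑ i ∈ s, b i ≤ ∫ ω, ‖U ω - (P[U | G]) ω‖ ^ 2 ∂P := by
  have hE : MemLp (P[U | G]) 2 P := hU.condExp one_le_two
  have hW : MemLp (fun ω => U ω - (P[U | G]) ω) 2 P := hU.sub hE
  have hin : ∀ i {V : Ω → H}, MemLp V 2 P → MemLp (fun ω => inner ℝ (e i) (V ω)) 2 P :=
    fun i V hV => hV.const_inner (e i)
  have hterm : ∀ i ∈ s, b i ≤ ∫ ω, ‖inner ℝ (e i) (U ω - (P[U | G]) ω)‖ ^ 2 ∂P := by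
    intro i hi
    have hzero : ∫ ω, inner ℝ (e i) ((P[U | G]) ω) * Y i ω ∂P = 0 := by
      have hZ : StronglyMeasurable[G] fun ω => inner ℝ (e i) ((P[U | G]) ω) :=
        (continuous_const.inner continuous_id).comp_stronglyMeasurable stronglyMeasurable_condExp
      have h1 := condExp_mul_of_stronglyMeasurable_left (μ := P) hZ
        ((hin i hE).integrable_mul (hY i hi)) ((hY i hi).integrable one_le_two)
      rw [← integral_condExp hG]
      refine (integral_congr_ae (h1.trans ?_)).trans (integral_zero Ω ℝ)
      filter_upwards [hYG i hi] with ω hω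
      rw [Pi.mul_apply, hω, Pi.zero_apply, mul_zero]
    have hsub : ∫ ω, inner ℝ (e i) (U ω - (P[U | G]) ω) * Y i ω ∂P
        = ∫ ω, inner ℝ (e i) (U ω) * Y i ω ∂P := by
      have h1 : Integrable (fun ω => inner ℝ (e i) (U ω) * Y i ω) P :=
        (hin i hU).integrable_mul (hY i hi)
      have h2 : Integrable (fun ω => inner ℝ (e i) ((P[U | G]) ω) * Y i ω) P :=
        (hin i hE).integrable_mul (hY i hi)
      simp only [inner_sub_right, sub_mul]
      rw [integral_sub h1 h2, hzero, sub_zero]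
    have hcs := sq_integral_mul_le (hin i hW) (hY i hi)
    rw [hsub] at hcs
    simp only [Real.norm_eq_abs, sq_abs]
    exact le_of_mul_le_mul_right (((hb i hi).trans hcs).trans (mul_le_mul_of_nonneg_left
      (hYv i hi) (integral_nonneg fun ω => sq_nonneg _))) (hpos i hi)
  refine (Finset.sum_le_sum hterm).trans ?_
  have hsq : ∀ i, Integrable (fun ω => ‖inner ℝ (e i) (U ω - (P[U | G]) ω)‖ ^ 2) P :=
    fun i => (hin i hW).integrable_norm_pow two_ne_zero
  rw [← integral_finsetSum _ fun i _ => hsq i]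
  exact integral_mono (integrable_finsetSum _ fun i _ => hsq i)
    (hW.integrable_norm_pow two_ne_zero) fun ω => he.sum_inner_products_le _

/-! ### The mild solution as a random element of `L²(𝕋)` -/

/-- In a separable space the open balls generate the Borel sets. -/
theorem measurable_of_measurable_dist {Ω E : Type*} [MeasurableSpace Ω] [PseudoMetricSpace E]
    [SecondCountableTopology E] [MeasurableSpace E] [BorelSpace E] {f : Ω → E}
    (hf : ∀ y, Measurable fun ω => dist (f ω) y) : Measurable f := by
  have hbasis : TopologicalSpace.IsTopologicalBasis
      {B : Set E | ∃ y r, B = Metric.ball y r} := by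
    refine TopologicalSpace.isTopologicalBasis_of_isOpen_of_nhds ?_ fun x U hx hU => ?_
    · rintro _ ⟨y, r, rfl⟩
      exact Metric.isOpen_ball
    · obtain ⟨r, hr, hrU⟩ := Metric.isOpen_iff.1 hU x hx
      exact ⟨_, ⟨x, r, rfl⟩, Metric.mem_ball_self hr, hrU⟩
  rw [BorelSpace.measurable_eq (α := E), hbasis.borel_eq_generateFrom]
  refine measurable_generateFrom ?_
  rintro _ ⟨y, r, rfl⟩
  exact measurableSet_lt (hf y) measurable_const

theorem coeFn_toL2 (g : C(UnitAddCircle, ℝ)) : toL2 g =ᵐ[volume] g :=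
  ContinuousMap.coeFn_toLp (p := 2) (𝕜 := ℝ) volume g

theorem inner_toL2 (f g : C(UnitAddCircle, ℝ)) : inner ℝ (toL2 f) (toL2 g) = ∫ x, g x * f x := by
  rw [L2.inner_def]
  refine integral_congr_ae ?_
  filter_upwards [coeFn_toL2 f, coeFn_toL2 g] with x h1 h2
  rw [h1, h2]
  simp

theorem stronglyMeasurable_toL2 {Ω : Type*} [MeasurableSpace Ω] {X : Ω → C(UnitAddCircle, ℝ)}
    (hX : ∀ x, Measurable fun ω => X ω x) : StronglyMeasurable fun ω => toL2 (X ω) := by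
  have : Fact ((2 : ℝ≥0∞) ≠ ∞) := ⟨ENNReal.ofNat_ne_top⟩
  borelize ↥(Lp ℝ 2 (volume : Measure UnitAddCircle))
  refine Measurable.stronglyMeasurable (measurable_of_measurable_dist fun y => ?_)
  have hd : ∀ ω, dist (toL2 (X ω)) y = √(∫ x, (X ω x - y x) ^ 2) := by
    intro ω
    rw [dist_eq_norm, ← Real.sqrt_sq (norm_nonneg (toL2 (X ω) - y)), ← real_inner_self_eq_norm_sq,
      L2.inner_def]
    congr 1
    refine integral_congr_ae ?_
    filter_upwards [coeFn_toL2 (X ω), Lp.coeFn_sub (toL2 (X ω)) y] with x h1 h2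
    rw [h2, Pi.sub_apply, h1]
    simp [pow_two]
  simp only [hd]
  refine Measurable.sqrt (StronglyMeasurable.integral_prod_right
    (f := fun (ω : Ω) (x : UnitAddCircle) => (X ω x - y x) ^ 2) ?_).measurable
  exact ((stronglyMeasurable_uncurry_field hX).sub
    ((Lp.stronglyMeasurable y).comp_measurable measurable_snd)).pow 2

theorem fourierCoeff_ofReal (g : C(UnitAddCircle, ℝ)) (n : ℤ) :
    fourierCoeff (fun x => (g x : ℂ)) n
      = ⟨∫ x, g x * cosMode n x, -∫ x, g x * sinMode n x⟩ := by
  have hi : Integrable (fun x : UnitAddCircle => fourier (-n) x • (g x : ℂ)) :=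
    integrable_of_continuous (by fun_prop)
  rw [fourierCoeff, haarAddCircle_eq_volume]
  refine Complex.ext ?_ ?_
  · rw [← RCLike.re_eq_complex_re, ← integral_re hi]
    refine integral_congr_ae (Eventually.of_forall fun x => ?_)
    simp [mul_comm]
  · rw [← RCLike.im_eq_complex_im, ← integral_im hi, ← integral_neg]
    refine integral_congr_ae (Eventually.of_forall fun x => ?_)
    simp [mul_comm]

/-- Parseval for a real function, with the sum over all of `ℤ`, so that each frequency `n ≠ 0` is
counted for `n` and for `-n`. -/
theorem enorm_toL2_sq (g : C(UnitAddCircle, ℝ)) :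
    ‖toL2 g‖ₑ ^ 2 = ∑' n : ℤ, (‖∫ x, g x * cosMode n x‖ₑ ^ 2 + ‖∫ x, g x * sinMode n x‖ₑ ^ 2) := by
  set gc : C(UnitAddCircle, ℂ) := ⟨fun x => (g x : ℂ), by fun_prop⟩ with hgc
  have h := hasSum_sq_fourierCoeff (T := 1)
    (ContinuousMap.toLp (E := ℂ) 2 AddCircle.haarAddCircle ℂ gc)
  have h1 : ∫ t, ‖ContinuousMap.toLp (E := ℂ) 2 AddCircle.haarAddCircle ℂ gc t‖ ^ 2
      ∂(AddCircle.haarAddCircle : Measure UnitAddCircle) = ‖toL2 g‖ ^ 2 := by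
    rw [← real_inner_self_eq_norm_sq, inner_toL2, ← haarAddCircle_eq_volume]
    refine integral_congr_ae ?_
    filter_upwards [ContinuousMap.coeFn_toLp (p := 2) (𝕜 := ℂ) AddCircle.haarAddCircle gc]
      with x hx
    rw [hx]
    simp [hgc, pow_two]
  have h2 : ∀ n : ℤ, ‖fourierCoeff
      (ContinuousMap.toLp (E := ℂ) 2 AddCircle.haarAddCircle ℂ gc : UnitAddCircle → ℂ) n‖ ^ 2
      = (∫ x, g x * cosMode n x) ^ 2 + (∫ x, g x * sinMode n x) ^ 2 := by
    intro n
    rw [fourierCoeff_toLp, ← Complex.normSq_eq_norm_sq,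
      show (gc : UnitAddCircle → ℂ) = fun x => (g x : ℂ) from rfl, fourierCoeff_ofReal,
      Complex.normSq_mk]
    ring
  simp only [h1, h2] at h
  have h3 : ∀ a : ℝ, ‖a‖ₑ ^ 2 = ENNReal.ofReal (a ^ 2) := fun a => by
    rw [← ofReal_norm, ← ENNReal.ofReal_pow (norm_nonneg _), Real.norm_eq_abs, sq_abs]
  simp only [h3]
  rw [← ofReal_norm, ← ENNReal.ofReal_pow (norm_nonneg _), ← h.tsum_eq,
    ENNReal.ofReal_tsum_of_nonneg (fun n => by positivity) h.summable]
  exact tsum_congr fun n => ENNReal.ofReal_add (sq_nonneg _) (sq_nonneg _)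

theorem norm_cosMode_le (n : ℤ) : ‖cosMode n‖ ≤ 1 := by
  rw [ContinuousMap.norm_le _ zero_le_one]
  intro x
  rw [cosMode_apply, Real.norm_eq_abs]
  refine (Complex.abs_re_le_norm _).trans ?_
  rw [fourier_apply, Circle.norm_coe]

theorem norm_sinMode_le (n : ℤ) : ‖sinMode n‖ ≤ 1 := by
  rw [ContinuousMap.norm_le _ zero_le_one]
  intro x
  rw [sinMode_apply, Real.norm_eq_abs]
  refine (Complex.abs_im_le_norm _).trans ?_
  rw [fourier_apply, Circle.norm_coe]

/-- The value of the mild solution at time `1` is a square-integrable element of `L²(𝕋)`. -/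
theorem IsMildSolution.memLp_toL2 {Ω : Type*} [MeasurableSpace Ω] {P : Measure Ω}
    [IsProbabilityMeasure P] {ξ : CylSet 1 → Lp ℝ 2 P} {O u : ℝ → Ω → C(UnitAddCircle, ℝ)}
    (hξ : IsWhiteNoise ξ) (hO : IsStochasticConvolution ξ O)
    (hu : IsMildSolution P 1 (fun r => r) (fun _ => 0) O u) :
    MemLp (fun ω => toL2 (u 1 ω)) 2 P := by
  have hum := hu.field.measurable 1 (by simp)
  refine memLp_two_of_lintegral_lt_top (stronglyMeasurable_toL2 hum).aestronglyMeasurable ?_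
  simp only [enorm_toL2_sq]
  have hm : ∀ f : C(UnitAddCircle, ℝ), Measurable fun ω => ‖∫ x, u 1 ω x * f x‖ₑ ^ 2 :=
    fun f => (measurable_integral_mul hum f).enorm.pow_const 2
  have hm2 : ∀ n : ℤ, Measurable fun ω =>
      ‖∫ x, u 1 ω x * cosMode n x‖ₑ ^ 2 + ‖∫ x, u 1 ω x * sinMode n x‖ₑ ^ 2 :=
    fun n => (hm _).add (hm _)
  rw [lintegral_tsum fun n => (hm2 n).aemeasurable]
  -- The second moment of the `n`-th mode is of order `1 / modeRate n`, which is summable.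
  set c : ℤ → ℝ≥0∞ := fun n => if n = 0 then 1 else ENNReal.ofReal (modeRate n)⁻¹ with hc
  have hsq : ∀ n, (c n ^ (1 / 2 : ℝ)) ^ 2 = c n := fun n => by
    rw [← ENNReal.rpow_natCast, ← ENNReal.rpow_mul]; norm_num
  have hdecay : ∀ n s, ∫⁻ r in Icc (0 : ℝ) 1, ‖decay (modeRate n) s r‖ₑ ^ 2
      ≤ (c n ^ (1 / 2 : ℝ)) ^ 2 := by
    intro n s
    rw [hsq]
    by_cases hn : n = 0
    · simpa only [hc, if_pos hn] using lintegral_decay_sq_le_one (modeRate_nonneg n) s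
    · simpa only [hc, if_neg hn] using lintegral_decay_sq_le_inv (modeRate_pos hn) s
  have hmode : ∀ n (f : C(UnitAddCircle, ℝ)), ‖f‖ ≤ 1 → IsHeatEigen f (modeRate n) →
      ∫⁻ ω, ‖∫ x, u 1 ω x * f x‖ₑ ^ 2 ∂P ≤ 16 * c n := by
    intro n f hf1 hf
    rw [← eLpNorm_two_sq]
    refine (pow_le_pow_left' (hu.eLpNorm_pairing_le hξ hO hf1 (modeRate_nonneg n) hf (hdecay n))
      2).trans (le_of_eq ?_)
    rw [mul_pow, hsq]
    norm_num
  have hsum : ∀ n, ∫⁻ ω, (‖∫ x, u 1 ω x * cosMode n x‖ₑ ^ 2 + ‖∫ x, u 1 ω x * sinMode n x‖ₑ ^ 2) ∂P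
      ≤ 32 * c n := by
    intro n
    rw [lintegral_add_left (hm _)]
    refine (add_le_add (hmode n _ (norm_cosMode_le n) (isHeatEigen_cosMode n))
      (hmode n _ (norm_sinMode_le n) (isHeatEigen_sinMode n))).trans (le_of_eq ?_)
    rw [← add_mul]; norm_num
  refine (ENNReal.tsum_le_tsum hsum).trans_lt ?_
  rw [ENNReal.tsum_mul_left]
  refine ENNReal.mul_lt_top (by norm_num) ?_
  have hc2 : ∀ n, c n ≤ (if n = 0 then 1 else 0) + ENNReal.ofReal (modeRate n)⁻¹ := by
    intro n
    by_cases hn : n = 0 <;> simp [hc, hn]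
  refine (ENNReal.tsum_le_tsum hc2).trans_lt ?_
  rw [ENNReal.tsum_add, tsum_ite_eq, ← ENNReal.ofReal_tsum_of_nonneg
    (fun n => inv_nonneg.2 (modeRate_nonneg n)) summable_inv_modeRate]
  exact ENNReal.add_lt_top.2 ⟨ENNReal.one_lt_top, ENNReal.ofReal_lt_top⟩

/-! ### Noise integrals independent of the observations -/

theorem integral_cosMode_mul_cosMode (m n : ℤ) : ∫ x, cosMode m x * cosMode n x
    = ((if m + n = 0 then 1 else 0) + (if m = n then 1 else 0)) / 2 := by
  have h1 := integral_fourier_mul_fourier m n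
  have h2 := integral_fourier_mul_fourier m (-n)
  have hi : ∀ k : ℤ, Integrable fun x : UnitAddCircle => fourier m x * fourier k x :=
    fun k => integrable_of_continuous (by fun_prop)
  have h3 : ∀ x : UnitAddCircle, cosMode m x * cosMode n x
      = (RCLike.re (fourier m x * fourier n x) + RCLike.re (fourier m x * fourier (-n) x)) / 2 := by
    intro x
    rw [fourier_neg]
    simp only [cosMode_apply, RCLike.re_eq_complex_re, Complex.mul_re, Complex.conj_re,
      Complex.conj_im]
    ring
  simp only [h3]
  rw [integral_div, integral_add (hi n).re (hi (-n)).re, integral_re (hi n), integral_re (hi (-n)),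
    h1, h2]
  simp only [← sub_eq_add_neg, sub_eq_zero]
  split_ifs <;> simp

theorem integral_cosMode_mul_sinMode (m n : ℤ) : ∫ x, cosMode m x * sinMode n x = 0 := by
  have h1 := integral_fourier_mul_fourier m n
  have h2 := integral_fourier_mul_fourier m (-n)
  have hi : ∀ k : ℤ, Integrable fun x : UnitAddCircle => fourier m x * fourier k x :=
    fun k => integrable_of_continuous (by fun_prop)
  have h3 : ∀ x : UnitAddCircle, cosMode m x * sinMode n x
      = (RCLike.im (fourier m x * fourier n x) - RCLike.im (fourier m x * fourier (-n) x)) / 2 := by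
    intro x
    rw [fourier_neg]
    simp only [cosMode_apply, sinMode_apply, RCLike.im_eq_complex_im, Complex.mul_im,
      Complex.conj_re, Complex.conj_im]
    ring
  simp only [h3]
  rw [integral_div, integral_sub (hi n).im (hi (-n)).im, integral_im (hi n), integral_im (hi (-n)),
    h1, h2]
  split_ifs <;> simp

section Grid

variable {Ω : Type*} [mΩ : MeasurableSpace Ω] {P : Measure Ω} {ξ : CylSet 1 → Lp ℝ 2 P}
  {O u : ℝ → Ω → C(UnitAddCircle, ℝ)} {M : ℕ} {I : Set ℝ}

/-- The real Fourier mode selected by a frequency and a flag: cosine for `true`, sine for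
`false`. -/
def realMode (n : ℤ) (b : Bool) : C(UnitAddCircle, ℝ) := if b then cosMode n else sinMode n

theorem isHeatEigen_realMode (n : ℤ) (b : Bool) : IsHeatEigen (realMode n b) (modeRate n) := by
  cases b
  · exact isHeatEigen_sinMode n
  · exact isHeatEigen_cosMode n

/-- The real and imaginary parts (up to sign) of the observed Fourier coefficients. -/
def gridMode (O : ℝ → Ω → C(UnitAddCircle, ℝ)) (M : ℕ) (I : Set ℝ)
    (i : Fin (M + 1) × {n : ℤ // (n : ℝ) ∈ I} × Bool) (ω : Ω) : ℝ :=
  ∫ x, O (i.1.1 * (1 / M)) ω x * realMode i.2.1.1 i.2.2 x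

theorem gridTime_mem (hM : 1 ≤ M) (k : Fin (M + 1)) : (k.1 * (1 / M) : ℝ) ∈ Icc (0 : ℝ) 1 := by
  have h1 : (0 : ℝ) < M := by exact_mod_cast hM
  have h2 : (k.1 : ℝ) ≤ M := by exact_mod_cast Nat.lt_succ_iff.1 k.2
  refine ⟨by positivity, ?_⟩
  rw [mul_one_div]
  exact (div_le_one h1).2 h2

/-- The observed σ-algebra is generated by the real grid modes; only one inclusion is needed. -/
theorem gridSigma_le_comap {Ω : Type*} {O : ℝ → Ω → C(UnitAddCircle, ℝ)} :
    gridSigma 1 O M I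
    ≤ MeasurableSpace.comap (fun ω i => gridMode O M I i ω) inferInstance := by
  refine iSup_le fun k => iSup_le fun n => ?_
  set F : (Fin (M + 1) × {n : ℤ // (n : ℝ) ∈ I} × Bool → ℝ) → ℂ :=
    fun y => (y (k, n, true) : ℂ) + (-y (k, n, false) : ℝ) * Complex.I with hF
  have hFm : Measurable F := by fun_prop
  have h : (fun ω => fourierCoeff (fun x => (O (k.1 * (1 / M)) ω x : ℂ)) n.1)
      = F ∘ fun ω i => gridMode O M I i ω := by
    funext ω
    rw [fourierCoeff_ofReal, Complex.mk_eq_add_mul_I]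
    rfl
  rw [h, ← MeasurableSpace.comap_comp]
  exact MeasurableSpace.comap_mono hFm.comap_le

theorem IsContinuousField.measurable_gridMode (hO : IsContinuousField P 1 O) (hM : 1 ≤ M)
    (i : Fin (M + 1) × {n : ℤ // (n : ℝ) ∈ I} × Bool) : Measurable (gridMode O M I i) :=
  measurable_integral_mul (hO.measurable _ (gridTime_mem hM i.1)) _

theorem IsContinuousField.gridSigma_le (hO : IsContinuousField P 1 O) (hM : 1 ≤ M) :
    gridSigma 1 O M I ≤ mΩ :=
  gridSigma_le_comap.trans (measurable_pi_lambda _ fun i => hO.measurable_gridMode hM i).comap_le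

/-- A noise integral with a product integrand is unpredictable from the observations as soon as it is
orthogonal, in space or in time, to each integrand that represents an observed mode. -/
theorem condExp_gridSigma_eq_zero [IsProbabilityMeasure P] (hξ : IsWhiteNoise ξ)
    (hO : IsStochasticConvolution ξ O) (hM : 1 ≤ M) {φ : ℝ → ℝ}
    (hφ : MemLp φ 2 (volume.restrict (Icc 0 1))) {g : C(UnitAddCircle, ℝ)}
    (h : ∀ (k : Fin (M + 1)) (n : ℤ) (b : Bool), (n : ℝ) ∈ I →
      (∫ y, g y * realMode n b y) = 0 ∨
        ∫ r in Icc (0 : ℝ) 1, φ r * decay (modeRate n) (k.1 * (1 / M)) r = 0) :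
    P[noiseIntegral ξ (tensor φ g) | gridSigma 1 O M I] =ᵐ[P] 0 := by
  refine hξ.condExp_noiseIntegral_eq_zero (memLp_tensor hφ g)
    (h := fun i : Fin (M + 1) × {n : ℤ // (n : ℝ) ∈ I} × Bool =>
      tensor (decay (modeRate i.2.1.1) (i.1.1 * (1 / M))) (realMode i.2.1.1 i.2.2))
    (fun i => memLp_tensor (memLp_decay (modeRate_nonneg _) 1 _) _) (fun i => ?_)
    (fun i => hO.field.measurable_gridMode hM i)
    (fun i => hO.integral_mul_ae_eq hξ (modeRate_nonneg _) (isHeatEigen_realMode _ _)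
      (gridTime_mem hM i.1)) gridSigma_le_comap
  rw [integral_tensor_mul_tensor]
  rcases h i.1 i.2.1.1 i.2.2 i.2.1.2 with h | h <;> rw [h] <;> simp

end Grid

theorem integral_decay_mul {l t : ℝ} (ht : t ∈ Icc (0 : ℝ) 1) (φ : ℝ → ℝ) :
    ∫ r in Icc (0 : ℝ) 1, decay l t r * φ r
      = ∫ r in (0)..t, Real.exp (-(l * (t - r))) * φ r := by
  have h : ∀ r, decay l t r * φ r
      = (Iio t).indicator (fun r => Real.exp (-(l * (t - r))) * φ r) r := by
    intro r
    by_cases hr : r ∈ Iio t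
    · rw [decay, indicator_of_mem hr, indicator_of_mem hr]
    · rw [decay, indicator_of_notMem hr, indicator_of_notMem hr, zero_mul]
  simp only [h]
  have hset : Icc 0 1 ∩ Iio t = Ico 0 t := by
    ext r
    simp only [mem_inter_iff, mem_Icc, mem_Iio, mem_Ico]
    exact ⟨fun h => ⟨h.1.1, h.2⟩, fun h => ⟨⟨h.1, h.2.le.trans ht.2⟩, h.2⟩⟩
  rw [setIntegral_indicator measurableSet_Iio, hset, integral_Ico_eq_integral_Ioc,
    intervalIntegral.integral_of_le ht.1]

theorem integral_sin_const_mul {a : ℝ} (ha : a ≠ 0) (t : ℝ) :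
    ∫ r in (0)..t, Real.sin (a * r) = (1 - Real.cos (a * t)) / a := by
  rw [intervalIntegral.integral_comp_mul_left (f := Real.sin) ha, integral_sin]
  simp [div_eq_inv_mul]

theorem integral_cos_const_mul {a : ℝ} (ha : a ≠ 0) (t : ℝ) :
    ∫ r in (0)..t, Real.cos (a * r) = Real.sin (a * t) / a := by
  rw [intervalIntegral.integral_comp_mul_left (f := Real.cos) ha, integral_cos]
  simp [div_eq_inv_mul]

theorem memLp_of_continuous {φ : ℝ → ℝ} (hφ : Continuous φ) :
    MemLp φ 2 (volume.restrict (Icc (0 : ℝ) 1)) := by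
  obtain ⟨C, hC⟩ := isCompact_Icc.exists_bound_of_continuousOn (s := Icc (0 : ℝ) 1) hφ.continuousOn
  refine MemLp.of_bound hφ.aestronglyMeasurable C ?_
  filter_upwards [ae_restrict_mem measurableSet_Icc] with r hr using hC r hr

/-! ### The lower bound -/

/-- The normalised real cosine basis functions: `1`, and `√2 cos (2 π k x)` for `k ≥ 1`. -/
def cosBasis (k : ℕ) : C(UnitAddCircle, ℝ) := (if k = 0 then 1 else √2 : ℝ) • cosMode k

theorem orthonormal_cosBasis : Orthonormal ℝ fun k => toL2 (cosBasis k) := by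
  rw [orthonormal_iff_ite]
  intro i j
  have h : ∀ x, cosBasis j x * cosBasis i x = ((if j = 0 then 1 else √2 : ℝ)
      * (if i = 0 then 1 else √2 : ℝ)) * (cosMode j x * cosMode i x) := by
    intro x
    simp only [cosBasis, ContinuousMap.smul_apply, smul_eq_mul]
    ring
  rw [inner_toL2]
  simp only [h]
  rw [integral_const_mul, integral_cosMode_mul_cosMode]
  have h1 : (j : ℤ) + i = 0 ↔ j = 0 ∧ i = 0 := by omega
  have h2 : (j : ℤ) = i ↔ i = j := by omega
  simp only [h1, h2]
  rcases eq_or_ne i j with rfl | hij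
  · by_cases hi : i = 0
    · simp [hi]
    · simp [hi]
  · have : ¬ (j = 0 ∧ i = 0) := fun h => hij (h.2.trans h.1.symm)
    simp [hij, this]

theorem inner_cosBasis (k : ℕ) (g : C(UnitAddCircle, ℝ)) :
    inner ℝ (toL2 (cosBasis k)) (toL2 g)
      = (if k = 0 then 1 else √2 : ℝ) * ∫ x, g x * cosMode k x := by
  rw [inner_toL2, ← integral_const_mul]
  refine integral_congr_ae (Eventually.of_forall fun x => ?_)
  simp only [cosBasis, ContinuousMap.smul_apply, smul_eq_mul]
  ring

section Bounds

variable {Ω : Type*} [mΩ : MeasurableSpace Ω] {P : Measure Ω}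
  {ξ : CylSet 1 → Lp ℝ 2 P} {O u : ℝ → Ω → C(UnitAddCircle, ℝ)} {M N : ℕ}

/-- The time profile of the test variable for the mean of the solution: it oscillates between
consecutive observation times, so that its integral over every observation window vanishes. -/
def gridSine (M : ℕ) (r : ℝ) : ℝ := Real.sin (2 * Real.pi * M * r)

theorem memLp_gridSine (M : ℕ) : MemLp (gridSine M) 2 (volume.restrict (Icc (0 : ℝ) 1)) :=
  memLp_of_continuous (by unfold gridSine; fun_prop)

theorem integral_decay_mul_gridSine (hM : 1 ≤ M) {t : ℝ} (ht : t ∈ Icc (0 : ℝ) 1) :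
    ∫ r in Icc (0 : ℝ) 1, decay 0 t r * gridSine M r
      = (1 - Real.cos (2 * Real.pi * M * t)) / (2 * Real.pi * M) := by
  have hM' : (0 : ℝ) < M := by exact_mod_cast hM
  rw [integral_decay_mul ht]
  simp only [zero_mul, neg_zero, Real.exp_zero, one_mul, gridSine]
  exact integral_sin_const_mul (by positivity) t

theorem condExp_gridSine [IsProbabilityMeasure P] (hξ : IsWhiteNoise ξ)
    (hO : IsStochasticConvolution ξ O) (hM : 1 ≤ M)
    (I : Set ℝ) :
    P[noiseIntegral ξ (tensor (gridSine M) (cosMode 0)) | gridSigma 1 O M I] =ᵐ[P] 0 := by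
  have hM' : (0 : ℝ) < M := by exact_mod_cast hM
  refine condExp_gridSigma_eq_zero hξ hO hM (memLp_gridSine M) fun k n b _ => ?_
  by_cases hn : n = 0
  · right
    simp only [hn, modeRate_zero, mul_comm (gridSine M _)]
    rw [integral_decay_mul_gridSine hM (gridTime_mem hM k)]
    have h : 2 * Real.pi * M * (k.1 * (1 / M)) = k.1 * (2 * Real.pi) := by field_simp
    rw [h, Real.cos_nat_mul_two_pi, sub_self, zero_div]
  · left
    cases b
    · exact integral_cosMode_mul_sinMode 0 n
    · refine (integral_cosMode_mul_cosMode 0 n).trans ?_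
      simp [hn, Ne.symm hn]

theorem integral_sq_gridSine_le (hξ : IsWhiteNoise ξ) (M : ℕ) :
    ∫ ω, noiseIntegral ξ (tensor (gridSine M) (cosMode 0)) ω ^ 2 ∂P ≤ 1 := by
  have hm := memLp_tensor (memLp_gridSine M) (cosMode 0)
  simp only [pow_two]
  rw [hξ.integral_noiseIntegral_mul hm hm, integral_tensor_mul_tensor,
    integral_cosMode_mul_cosMode]
  have h : ∫ r in Icc (0 : ℝ) 1, gridSine M r * gridSine M r ≤ ∫ r in Icc (0 : ℝ) 1, 1 := by
    refine setIntegral_mono_on ((memLp_gridSine M).integrable_mul (memLp_gridSine M))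
      (integrable_const _) measurableSet_Icc fun r _ => ?_
    rw [← pow_two]
    exact Real.sin_sq_le_one _
  simpa using h

/-- The mean of the solution contains `∫₀¹ exp(1 - s) ô_s ds` with `ô` the mean of the stochastic
convolution. The covariance of `ô_s` with the test variable is nonnegative, vanishes at the grid
times and averages to `(2 π M)⁻¹` over the unit interval. -/
theorem le_integral_mean_mul_gridSine [IsProbabilityMeasure P] (hξ : IsWhiteNoise ξ)
    (hO : IsStochasticConvolution ξ O)
    (hu : IsMildSolution P 1 (fun r => r) (fun _ => 0) O u) (hM : 1 ≤ M) :
    (2 * Real.pi * M)⁻¹ ≤ ∫ ω, (∫ x, u 1 ω x * cosMode 0 x)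
      * noiseIntegral ξ (tensor (gridSine M) (cosMode 0)) ω ∂P := by
  have hM' : (0 : ℝ) < M := by exact_mod_cast hM
  have hf := isHeatEigen_cosMode 0
  rw [modeRate_zero] at hf
  rw [hu.integral_pairing_mul_noiseIntegral hξ hO (norm_cosMode_le 0) le_rfl hf (memLp_gridSine M),
    integral_cosMode_mul_cosMode, integral_decay_mul_gridSine hM (by simp)]
  have hQ : ∀ s ∈ uIcc (0 : ℝ) 1, Real.exp ((1 - 0) * (1 - s))
      * ∫ r in Icc (0 : ℝ) 1, decay 0 s r * gridSine M r = Real.exp (1 - s)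
        * ((1 - Real.cos (2 * Real.pi * M * s)) / (2 * Real.pi * M)) := by
    intro s hs
    rw [uIcc_of_le zero_le_one] at hs
    rw [integral_decay_mul_gridSine hM hs, sub_zero, one_mul]
  rw [intervalIntegral.integral_congr hQ]
  have h1 : ∫ s in (0 : ℝ)..1, (1 - Real.cos (2 * Real.pi * M * s)) / (2 * Real.pi * M)
      = (2 * Real.pi * M)⁻¹ := by
    rw [intervalIntegral.integral_div, intervalIntegral.integral_sub
      (Continuous.intervalIntegrable (by fun_prop) _ _)
      (Continuous.intervalIntegrable (by fun_prop) _ _),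
      integral_cos_const_mul (by positivity)]
    have : 2 * Real.pi * M * 1 = (2 * M : ℕ) * Real.pi := by push_cast; ring
    rw [this, Real.sin_nat_mul_pi]
    simp
  have h2 : (2 * Real.pi * M)⁻¹ ≤ ∫ s in (0 : ℝ)..1, Real.exp (1 - s)
      * ((1 - Real.cos (2 * Real.pi * M * s)) / (2 * Real.pi * M)) := by
    rw [← h1]
    refine intervalIntegral.integral_mono_on zero_le_one
      (Continuous.intervalIntegrable (by fun_prop) _ _)
      (Continuous.intervalIntegrable (by fun_prop) _ _) fun s hs => ?_
    refine le_mul_of_one_le_left (div_nonneg ?_ (by positivity)) ?_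
    · linarith [Real.cos_le_one (2 * Real.pi * M * s)]
    · exact Real.one_le_exp (by linarith [hs.2])
  have h3 : 0 ≤ (1 - Real.cos (2 * Real.pi * M * 1)) / (2 * Real.pi * M) :=
    div_nonneg (by linarith [Real.cos_le_one (2 * Real.pi * M * 1)]) (by positivity)
  norm_num at h3 h2 ⊢
  linarith

/-- The variance `∫₀¹ exp(-2 l (1 - r)) dr` of a mode of the stochastic convolution at time `1`. -/
def modeVariance (l : ℝ) : ℝ := ∫ r in Icc (0 : ℝ) 1, decay l 1 r * decay l 1 r

/-- For a decay rate bounded away from `0`, the variance of a mode is at least of the order of the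
inverse of the rate. -/
theorem le_modeVariance {l : ℝ} (hl : 1 ≤ l) : (4 * l)⁻¹ ≤ modeVariance l := by
  have h1 : modeVariance l = ∫ r in (0 : ℝ)..1, Real.exp (2 * l * r - 2 * l) := by
    rw [modeVariance, integral_decay_mul (by simp)]
    refine intervalIntegral.integral_congr_ae ?_
    have : ∀ᵐ r : ℝ, r ≠ 1 := by simp [ae_iff]
    filter_upwards [this] with r hr1 hr
    rw [uIoc_of_le zero_le_one] at hr
    rw [decay, indicator_of_mem (show r ∈ Iio 1 from lt_of_le_of_ne hr.2 hr1), ← Real.exp_add]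
    congr 1; ring
  have h2 : ∫ r in (0 : ℝ)..1, Real.exp (2 * l * r - 2 * l)
      = (1 - Real.exp (-(2 * l))) / (2 * l) := by
    rw [intervalIntegral.integral_comp_mul_sub (f := Real.exp) (by positivity), integral_exp]
    simp [div_eq_inv_mul]
  have h3 : Real.exp (-(2 * l)) ≤ 1 / 2 := by
    rw [Real.exp_neg, one_div]
    exact inv_anti₀ two_pos (by linarith [Real.add_one_le_exp (2 * l)])
  rw [h1, h2, le_div_iff₀ (by positivity)]
  have : (4 * l)⁻¹ * (2 * l) = 1 / 2 := by field_simp; norm_num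
  linarith

/-- Frequencies above `N` are orthogonal to everything observed. -/
theorem condExp_highMode [IsProbabilityMeasure P] (hξ : IsWhiteNoise ξ)
    (hO : IsStochasticConvolution ξ O) (hM : 1 ≤ M)
    {k : ℕ} (hk : N < k) :
    P[noiseIntegral ξ (tensor (decay (modeRate k) 1) (cosMode k))
      | gridSigma 1 O M (Icc (-(N : ℝ)) N)] =ᵐ[P] 0 := by
  refine condExp_gridSigma_eq_zero hξ hO hM (memLp_decay (modeRate_nonneg _) 1 1)
    fun _ n b hn => Or.inl ?_
  have h1 : -(N : ℤ) ≤ n := by exact_mod_cast hn.1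
  have h2 : n ≤ (N : ℤ) := by exact_mod_cast hn.2
  cases b
  · exact integral_cosMode_mul_sinMode k n
  · refine (integral_cosMode_mul_cosMode k n).trans ?_
    rw [if_neg (by omega), if_neg (by omega)]
    simp

theorem integral_sq_highMode (hξ : IsWhiteNoise ξ) {k : ℕ} (hk : k ≠ 0) :
    ∫ ω, noiseIntegral ξ (tensor (decay (modeRate k) 1) (cosMode k)) ω ^ 2 ∂P
      = modeVariance (modeRate k) / 2 := by
  have hm := memLp_tensor (memLp_decay (modeRate_nonneg k) 1 1) (cosMode k)
  simp only [pow_two]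
  rw [hξ.integral_noiseIntegral_mul hm hm, integral_tensor_mul_tensor,
    integral_cosMode_mul_cosMode, if_neg (by omega), if_pos rfl, modeVariance]
  ring

/-- The drift only adds to the covariance with the stochastic convolution, all covariances between
its values at different times being nonnegative. -/
theorem le_integral_highMode [IsProbabilityMeasure P] (hξ : IsWhiteNoise ξ)
    (hO : IsStochasticConvolution ξ O)
    (hu : IsMildSolution P 1 (fun r => r) (fun _ => 0) O u) {k : ℕ} (hk : k ≠ 0) :
    modeVariance (modeRate k) / 2 ≤ ∫ ω, (∫ x, u 1 ω x * cosMode k x)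
      * noiseIntegral ξ (tensor (decay (modeRate k) 1) (cosMode k)) ω ∂P := by
  rw [hu.integral_pairing_mul_noiseIntegral hξ hO (norm_cosMode_le k) (modeRate_nonneg k)
    (isHeatEigen_cosMode k) (memLp_decay (modeRate_nonneg k) 1 1),
    integral_cosMode_mul_cosMode, if_neg (by omega), if_pos rfl, modeVariance]
  have h : 0 ≤ ∫ s in (0 : ℝ)..1, Real.exp ((1 - modeRate k) * (1 - s))
      * ∫ r in Icc (0 : ℝ) 1, decay (modeRate k) s r * decay (modeRate k) 1 r :=
    intervalIntegral.integral_nonneg zero_le_one fun s _ => mul_nonneg (Real.exp_pos _).le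
      (integral_nonneg fun r => mul_nonneg (decay_nonneg _ _ _) (decay_nonneg _ _ _))
  linarith

/-- The squared error dominates the contribution of frequency `0`, of order `M⁻²`, plus those of the
`N` frequencies in `(N, 2N]`, each of order `N⁻²`. -/
theorem le_integral_error_sq [IsProbabilityMeasure P] (hξ : IsWhiteNoise ξ)
    (hO : IsStochasticConvolution ξ O)
    (hu : IsMildSolution P 1 (fun r => r) (fun _ => 0) O u) (hM : 1 ≤ M) (hN : 1 ≤ N) :
    (4 * Real.pi ^ 2 * M ^ 2)⁻¹ + (64 * Real.pi ^ 2 * N)⁻¹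
      ≤ ∫ ω, ‖toL2 (u 1 ω) - (P[fun ω => toL2 (u 1 ω) | gridSigma 1 O M (Icc (-(N : ℝ)) N)]) ω‖ ^ 2
        ∂P := by
  have hM' : (0 : ℝ) < M := by exact_mod_cast hM
  have hN' : (0 : ℝ) < N := by exact_mod_cast hN
  -- Frequency `0` detects the time resolution, the frequencies in `(N, 2N]` the space resolution.
  set Y : ℕ → Ω → ℝ := fun k => if k = 0 then noiseIntegral ξ (tensor (gridSine M) (cosMode 0))
    else noiseIntegral ξ (tensor (decay (modeRate k) 1) (cosMode k)) with hYdef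
  set b : ℕ → ℝ := fun k => if k = 0 then (4 * Real.pi ^ 2 * M ^ 2)⁻¹
    else (64 * Real.pi ^ 2 * N ^ 2)⁻¹ with hbdef
  set v : ℕ → ℝ := fun k => if k = 0 then 1 else modeVariance (modeRate k) / 2 with hvdef
  have hvar : ∀ k ∈ Finset.Ioc N (2 * N), (64 * Real.pi ^ 2 * N ^ 2 : ℝ)⁻¹
      ≤ modeVariance (modeRate k) := by
    intro k hk
    rw [Finset.mem_Ioc] at hk
    have h1 : (1 : ℝ) ≤ k := by exact_mod_cast (by omega : 1 ≤ k)
    have h2 : (k : ℝ) ≤ 2 * N := by exact_mod_cast hk.2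
    have h3 : (1 : ℝ) ≤ modeRate k := by
      unfold modeRate
      push_cast
      nlinarith [Real.pi_gt_three, one_le_pow₀ (n := 2) h1]
    refine le_trans (inv_anti₀ (by linarith) ?_) (le_modeVariance h3)
    unfold modeRate
    push_cast
    have h4 : (k : ℝ) ^ 2 ≤ (2 * N) ^ 2 := pow_le_pow_left₀ (by linarith) h2 2
    nlinarith [mul_le_mul_of_nonneg_left h4 (sq_nonneg Real.pi)]
  have hvarpos : ∀ k ∈ Finset.Ioc N (2 * N), 0 < modeVariance (modeRate k) := fun k hk =>
    lt_of_lt_of_le (by positivity) (hvar k hk)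
  have hne : ∀ k ∈ Finset.Ioc N (2 * N), k ≠ 0 := fun k hk => by
    rw [Finset.mem_Ioc] at hk; omega
  have h0 : (0 : ℕ) ∉ Finset.Ioc N (2 * N) := fun h => hne 0 h rfl
  have hsum : ∑ k ∈ insert 0 (Finset.Ioc N (2 * N)), b k
      = (4 * Real.pi ^ 2 * M ^ 2)⁻¹ + (64 * Real.pi ^ 2 * N)⁻¹ := by
    rw [Finset.sum_insert h0]
    congr 1
    have h1 : ∀ k ∈ Finset.Ioc N (2 * N), b k = (64 * Real.pi ^ 2 * N ^ 2)⁻¹ :=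
      fun k hk => if_neg (hne k hk)
    rw [Finset.sum_congr rfl h1, Finset.sum_const, Nat.card_Ioc, nsmul_eq_mul,
      show 2 * N - N = N by omega]
    field_simp
  rw [← hsum]
  refine sum_le_integral_norm_sub_condExp_sq (hO.field.gridSigma_le hM) (hu.memLp_toL2 hξ hO)
    orthonormal_cosBasis _ (Y := Y) (v := v) ?_ ?_ ?_ ?_ ?_
  · intro k _
    simp only [hYdef]
    split_ifs <;> exact Lp.memLp _
  · refine fun k hk => ?_
    rcases Finset.mem_insert.1 hk with rfl | hk
    · exact condExp_gridSine hξ hO hM _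
    · simp only [hYdef, if_neg (hne k hk)]
      exact condExp_highMode hξ hO hM (Finset.mem_Ioc.1 hk).1
  · refine fun k hk => ?_
    rcases Finset.mem_insert.1 hk with rfl | hk
    · exact one_pos
    · simp only [hvdef, if_neg (hne k hk)]
      exact half_pos (hvarpos k hk)
  · refine fun k hk => ?_
    rcases Finset.mem_insert.1 hk with rfl | hk
    · exact integral_sq_gridSine_le hξ M
    · simp only [hYdef, hvdef, if_neg (hne k hk)]
      exact (integral_sq_highMode hξ (hne k hk)).le
  · refine fun k hk => ?_
    simp only [inner_cosBasis, mul_assoc, integral_const_mul]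
    rcases Finset.mem_insert.1 hk with rfl | hk
    · have h := le_integral_mean_mul_gridSine hξ hO hu hM
      simp only [hbdef, hvdef, hYdef, if_true, one_mul, mul_one]
      refine le_trans (le_of_eq ?_) (pow_le_pow_left₀ (by positivity) h 2)
      rw [inv_pow]; ring
    · have h := le_integral_highMode hξ hO hu (hne k hk)
      have hp := hvarpos k hk
      simp only [hbdef, hvdef, hYdef, if_neg (hne k hk)]
      rw [mul_pow, Real.sq_sqrt zero_le_two]
      have h2 := pow_le_pow_left₀ (by positivity) h 2
      have h3 := mul_le_mul_of_nonneg_right (hvar k hk) hp.le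
      nlinarith

theorem ofReal_le_eLpNorm_two {H : Type*} [NormedAddCommGroup H] {W : Ω → H} (hW : MemLp W 2 P)
    {c : ℝ} (h : c ^ 2 ≤ ∫ ω, ‖W ω‖ ^ 2 ∂P) : ENNReal.ofReal c ≤ eLpNorm W 2 P := by
  rcases le_total c 0 with hc | hc
  · rw [ENNReal.ofReal_of_nonpos hc]; exact zero_le
  rw [← ENNReal.pow_le_pow_left_iff two_ne_zero, eLpNorm_two_sq, ← ENNReal.ofReal_pow hc]
  refine (ENNReal.ofReal_le_ofReal h).trans (le_of_eq ?_)
  rw [ofReal_integral_eq_lintegral_ofReal (hW.integrable_norm_pow two_ne_zero)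
    (Eventually.of_forall fun ω => by positivity)]
  refine lintegral_congr fun ω => ?_
  rw [ENNReal.ofReal_pow (norm_nonneg _), ofReal_norm]

end Bounds

theorem rate_sq_le {M N : ℕ} (hM : 1 ≤ M) (hN : 1 ≤ N) :
    (((M : ℝ)⁻¹ + (N : ℝ) ^ (-(1 / 2) : ℝ)) / 30) ^ 2
      ≤ (4 * Real.pi ^ 2 * M ^ 2)⁻¹ + (64 * Real.pi ^ 2 * N)⁻¹ := by
  have hM' : (0 : ℝ) < M := by exact_mod_cast hM
  have hN' : (0 : ℝ) < N := by exact_mod_cast hN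
  set x := (M : ℝ)⁻¹ with hx
  set y := (N : ℝ) ^ (-(1 / 2) : ℝ) with hy
  have hy2 : y ^ 2 = (N : ℝ)⁻¹ := by
    rw [hy, ← Real.rpow_natCast, ← Real.rpow_mul hN'.le, ← Real.rpow_neg_one]
    norm_num
  have hpi : Real.pi ^ 2 ≤ 10 := by
    nlinarith [Real.pi_lt_d2, Real.pi_pos]
  have h1 : x ^ 2 / 40 ≤ (4 * Real.pi ^ 2 * M ^ 2)⁻¹ := by
    rw [mul_inv, ← inv_pow, ← hx, div_eq_inv_mul]
    exact mul_le_mul_of_nonneg_right (inv_anti₀ (by positivity) (by linarith)) (by positivity)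
  have h2 : y ^ 2 / 640 ≤ (64 * Real.pi ^ 2 * N)⁻¹ := by
    rw [mul_inv, ← hy2, div_eq_inv_mul]
    exact mul_le_mul_of_nonneg_right (inv_anti₀ (by positivity) (by linarith)) (by positivity)
  nlinarith [sq_nonneg (x - y / 16), sq_nonneg x, sq_nonneg y]

end StochHeat

end

theorem mainTheorem3 :
    ∃ K : ℕ, ∀ (Ω : Type*) [mΩ : MeasurableSpace Ω] (P : Measure Ω) [IsProbabilityMeasure P]
      (ξ : StochHeat.CylSet 1 → Lp ℝ 2 P) (O u : ℝ → Ω → C(UnitAddCircle, ℝ)),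
      StochHeat.IsWhiteNoise ξ →
      StochHeat.IsStochasticConvolution ξ O →
      StochHeat.IsMildSolution P 1 (fun r => r) (fun _ => 0) O u →
      MemLp (fun ω => StochHeat.toL2 (u 1 ω)) 2 P ∧
      ∀ M N : ℕ, K ≤ M → K ≤ N →
        StochHeat.gridSigma 1 O M (Icc (-(N : ℝ)) N) ≤ mΩ ∧
        StochHeat.bestError (StochHeat.gridSigma 1 O M (Icc (-(N : ℝ)) N)) P
            (fun ω => StochHeat.toL2 (u 1 ω))
          = StochHeat.condExpError (StochHeat.gridSigma 1 O M (Icc (-(N : ℝ)) N)) P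
              (fun ω => StochHeat.toL2 (u 1 ω)) ∧
        ENNReal.ofReal (((M : ℝ)⁻¹ + (N : ℝ) ^ (-(1 / 2) : ℝ)) / 30)
          ≤ StochHeat.condExpError (StochHeat.gridSigma 1 O M (Icc (-(N : ℝ)) N)) P
              (fun ω => StochHeat.toL2 (u 1 ω)) := by
  -- The bound holds for all grids with `M, N ≥ 1`, so `K = 1` is enough.
  refine ⟨1, fun Ω mΩ P _ ξ O u hξ hO hu => ⟨hu.memLp_toL2 hξ hO, fun M N hM hN => ?_⟩⟩
  have hG := hO.field.gridSigma_le (I := Icc (-(N : ℝ)) N) hM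
  have hU := hu.memLp_toL2 hξ hO
  refine ⟨hG, StochHeat.bestError_eq_condExpError hG hU, ?_⟩
  exact StochHeat.ofReal_le_eLpNorm_two (hU.sub (hU.condExp one_le_two))
    ((StochHeat.rate_sq_le hM hN).trans (StochHeat.le_integral_error_sq hξ hO hu hM hN))
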